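/- Let $\Omega\subset\mathbb R^d$, $d\ge 1$, be a bounded open set (for instance a bounded convex polygonal domain), let $(\cdot,\cdot)$ and $\|\cdot\|$ be the inner product and norm of $L_2(\Omega)$, let $\mathcal V=H_0^1(\Omega)$ and $a(v,w)=(\nabla v,\nabla w)$. Let $A=-\Delta$ be the Dirichlet Laplacian: $v\in\mathcal V$ lies in $\mathrm{dom}(A)$, with $Av=g\in L_2(\Omega)$, if $a(v,w)=(g,w)$ for all $w\in\mathcal V$ (so $\mathrm{dom}(A)=H^2(\Omega)\cap\mathcal V$ when $\Omega$ is convex); give $\mathrm{dom}(A)$ its graph norm. Put $\|v\|_1=\|A^{1/2}v\|=\|\nabla v\|$ for $v\in\mathcal V$ and $\|v\|_2=\|Av\|$ for $v\in\mathrm{dom}(A)$. Let $q\ge 0$ be an integer and let $0=t_0<t_1<\dots<t_N=T$, $N\ge1$, be a mesh with $I_n=(t_{n-1},t_n)$ and $k_n=t_n-t_{n-1}$. Functions that are piecewise with respect to the mesh are left-continuous at the nodes; $v_n^{-}=v(t_n)$ and $v_n^{+}$ are the one-sided limits at $t_n$, and $[v]_n=v_n^+-v_n^-$. Let $\mathcal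 V_q$ be the set of pairs $(V_1,V_2)$ whose components are, on each $(t_{n-1},t_n]$, polynomials in $t$ of degree at most $q$ with coefficients in $\mathcal V$, and let $\mathcal W$ be the set of pairs that are piecewise smooth in time (smooth on each $(t_{n-1},t_n]$ up to the end points) with values in $\mathrm{dom}(A)$. For $f\in L_1(0,T;L_2(\Omega))$ and $u_0,v_0\in\mathcal V$ set $$\begin{aligned}B((u_1,u_2),(v_1,v_2))=&\sum_{n=1}^{N}\int_{I_n}\{a(\dot u_1,v_1)-a(u_2,v_1)+(\dot u_2,v_2)+a(u_1,v_2)\}\,dt\\&+\sum_{n=1}^{N-1}\{a([u_1]_n,v_{1,n}^+)+([u_2]_n,v_{2,n}^+)\}+a(u_{1,0}^+,v_{1,0}^+)+(u_{2,0}^+,v_{2,0}^+),\end{aligned}$$ $$L((v_1,v_2))=\sum_{n=1}^{N}\int_{I_n}(f,v_2)\,dt+a(u_0,v_{1,0}^+)+(v_0,v_{2,0}^+).$$ Let $U=(U_1,U_2)\in\mathcal V_q$ be a solution of the dG($q$) problem $B(U,V)=L(V)$ for all $V\in\mathcal V_q$, $U_0^-=(u_0,v_0)$. Let $u=(u_1,u_2)$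 be a solution of the wave equation $\ddot u+Au=f$ in the form $B(u,v)=L(v)$ for all $v\in\mathcal W$, $(u_1(0),u_2(0))=(u_0,v_0)$, such that on each $(t_{n-1},t_n]$, up to the end points, $u_1$ is of class $C^{q+1}$ in time with values in $\mathrm{dom}(A)$ and $u_2$ is of class $C^{q+1}$ in time with values in $\mathcal V$. Let $e=(e_1,e_2)=(U_1,U_2)-(u_1,u_2)$. Then there is a constant $C>0$ depending only on $q$ (in particular independent of $T$, of the mesh, of $\Omega$ and of $u$) such that $$\|e_{1,N}^-\|_1+\|e_{2,N}^-\|\le C\sum_{n=1}^{N}k_n^{q+1}\int_{I_n}\{\|u_2^{(q+1)}\|_1+\|u_1^{(q+1)}\|_2\}\,dt$$ and $$\|e_{1,N}^-\|\le C\sum_{n=1}^{N}k_n^{q+1}\int_{I_n}\{\|u_2^{(q+1)}\|+\|u_1^{(q+1)}\|_1\}\,dt,$$ where $u_i^{(q+1)}$ denotes the $(q+1)$-st time derivative. -/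

import Mathlib

open MeasureTheory Set
open scoped ContDiff InnerProductSpace

noncomputable section

namespace WaveDG

/-! ### The spaces `L²(Ω)`, `H₀¹(Ω)` and the Dirichlet Laplacian -/

/-- `L²(Ω)`, with the inner product `(·,·)`. -/
abbrev L2 {d : ℕ} (Ω : Set (EuclideanSpace ℝ (Fin d))) : Type :=
  Lp ℝ 2 ((volume : Measure (EuclideanSpace ℝ (Fin d))).restrict Ω)

/-- `L²(Ω; ℝᵈ)`. -/
abbrev L2Vec {d : ℕ} (Ω : Set (EuclideanSpace ℝ (Fin d))) : Type :=
  Lp (EuclideanSpace ℝ (Fin d)) 2 ((volume : Measure (EuclideanSpace ℝ (Fin d))).restrict Ω)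

/-- The pairs `(φ, ∇φ)` with `φ ∈ C_c^∞(Ω)`, as elements of `L²(Ω) × L²(Ω; ℝᵈ)`. -/
def testGraph {d : ℕ} (Ω : Set (EuclideanSpace ℝ (Fin d))) :
    Set (WithLp 2 (L2 Ω × L2Vec Ω)) :=
  {p | ∃ φ : EuclideanSpace ℝ (Fin d) → ℝ,
    ContDiff ℝ ∞ φ ∧ HasCompactSupport φ ∧ tsupport φ ⊆ Ω ∧
    p.fst =ᵐ[volume.restrict Ω] φ ∧ p.snd =ᵐ[volume.restrict Ω] gradient φ}

/-- `H₀¹(Ω)`, the closure of `C_c^∞(Ω)` in the norm `(‖v‖² + ‖∇v‖²)^{1/2}`. An element `v` is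
stored together with its weak gradient, as the pair `(v, ∇v)`, which `v` determines
(`H01.eq_of_toL2_eq` below). -/
def H01Submodule {d : ℕ} (Ω : Set (EuclideanSpace ℝ (Fin d))) :
    Submodule ℝ (WithLp 2 (L2 Ω × L2Vec Ω)) :=
  (Submodule.span ℝ (testGraph Ω)).topologicalClosure

/-- The space `𝒱 = H₀¹(Ω)`; its topology is that of the `H¹` norm. -/
abbrev H01 {d : ℕ} (Ω : Set (EuclideanSpace ℝ (Fin d))) : Type := H01Submodule Ω

/-- The function `v ∈ L²(Ω)` underlying an element of `H₀¹(Ω)`. -/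
def H01.toL2 {d : ℕ} {Ω : Set (EuclideanSpace ℝ (Fin d))} (v : H01 Ω) : L2 Ω :=
  (v : WithLp 2 (L2 Ω × L2Vec Ω)).fst

/-- The weak gradient `∇v ∈ L²(Ω; ℝᵈ)` of an element of `H₀¹(Ω)`. -/
def H01.grad {d : ℕ} {Ω : Set (EuclideanSpace ℝ (Fin d))} (v : H01 Ω) : L2Vec Ω :=
  (v : WithLp 2 (L2 Ω × L2Vec Ω)).snd

/-- The energy inner product `a(v, w) = (∇v, ∇w)`. -/
def energy {d : ℕ} {Ω : Set (EuclideanSpace ℝ (Fin d))} (v w : H01 Ω) : ℝ :=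
  ⟪v.grad, w.grad⟫_ℝ

/-- The graph of `A = -Δ` with homogeneous Dirichlet boundary conditions: the pairs `(v, g)` with
`v ∈ H₀¹(Ω)`, `g ∈ L²(Ω)` and `a(v, w) = (g, w)` for all `w ∈ H₀¹(Ω)`, so that `g = A v`. -/
def dirichletGraph {d : ℕ} (Ω : Set (EuclideanSpace ℝ (Fin d))) :
    Submodule ℝ (WithLp 2 (H01 Ω × L2 Ω)) where
  carrier := {p | ∀ w : H01 Ω, energy p.fst w = ⟪p.snd, w.toL2⟫_ℝ}
  zero_mem' w := by simp [energy, H01.grad]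
  add_mem' {p r} hp hr w := by
    have h1 := hp w
    have h2 := hr w
    simp only [energy, H01.grad, WithLp.add_fst, WithLp.add_snd, Submodule.coe_add,
      inner_add_left] at h1 h2 ⊢
    rw [h1, h2]
  smul_mem' c p hp w := by
    have h1 := hp w
    simp only [energy, H01.grad, WithLp.smul_fst, WithLp.smul_snd, Submodule.coe_smul,
      real_inner_smul_left] at h1 ⊢
    rw [h1]

/-- `dom(A)` with the graph norm of the Dirichlet Laplacian `A = -Δ`; an element `v` is stored as
the pair `(v, A v)`. -/
abbrev DomA {d : ℕ} (Ω : Set (EuclideanSpace ℝ (Fin d))) : Type := dirichletGraph Ω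

/-- An element of `dom(A)` as an element of `H₀¹(Ω)`. -/
def DomA.toH01 {d : ℕ} {Ω : Set (EuclideanSpace ℝ (Fin d))} (v : DomA Ω) : H01 Ω :=
  (v : WithLp 2 (H01 Ω × L2 Ω)).fst

/-- `A v = -Δ v ∈ L²(Ω)` for `v ∈ dom(A)`. -/
def DomA.lap {d : ℕ} {Ω : Set (EuclideanSpace ℝ (Fin d))} (v : DomA Ω) : L2 Ω :=
  (v : WithLp 2 (H01 Ω × L2 Ω)).snd

/-- `‖v‖`, the `L²(Ω)` norm. -/
def norm0 {d : ℕ} {Ω : Set (EuclideanSpace ℝ (Fin d))} (v : H01 Ω) : ℝ := ‖v.toL2‖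

/-- `‖v‖₁ = ‖A^{1/2} v‖ = a(v, v)^{1/2} = ‖∇v‖` for `v ∈ H₀¹(Ω)`; see `hasSum_norm1_sq`. -/
def norm1 {d : ℕ} {Ω : Set (EuclideanSpace ℝ (Fin d))} (v : H01 Ω) : ℝ := ‖v.grad‖

/-- `‖v‖₂ = ‖A v‖` for `v ∈ dom(A)`; see `hasSum_norm2_sq`. -/
def norm2 {d : ℕ} {Ω : Set (EuclideanSpace ℝ (Fin d))} (v : DomA Ω) : ℝ := ‖v.lap‖

/-! ### Time meshes and piecewise functions of time

A function that is piecewise with respect to a mesh `t₀ < … < t_N` is taken to be left-continuous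
at the nodes: its value at `t_n` is its limit from the left, `v_n⁻ = v(t_n)`, and its pieces live
on the half-open intervals `(t_{n-1}, t_n]`. The limit from the right is `v_n⁺`. -/

/-- `0 = t₀ < t₁ < … < t_N = T`, `N ≥ 1`. -/
structure IsMesh (T : ℝ) (N : ℕ) (t : ℕ → ℝ) : Prop where
  pos : 0 < N
  zero : t 0 = 0
  last : t N = T
  lt : ∀ n < N, t n < t (n + 1)

/-- `v` is piecewise `C^m`: on each `(t_n, t_{n+1}]` it agrees with a function that is
`C^m` on the closed interval. -/
def PiecewiseContDiff {X : Type*} [NormedAddCommGroup X] [NormedSpace ℝ X]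
    (m : WithTop ℕ∞) (N : ℕ) (t : ℕ → ℝ) (v : ℝ → X) : Prop :=
  ∀ n < N, ∃ w : ℝ → X,
    ContDiffOn ℝ m w (Icc (t n) (t (n + 1))) ∧ EqOn v w (Ioc (t n) (t (n + 1)))

/-- `v` is on each `(t_n, t_{n+1}]` a polynomial in time of degree at most `q` with
coefficients in `X`. -/
def PiecewisePoly {X : Type*} [NormedAddCommGroup X] [NormedSpace ℝ X]
    (q N : ℕ) (t : ℕ → ℝ) (v : ℝ → X) : Prop :=
  ∀ n < N, ∃ c : ℕ → X,
    EqOn v (fun s => ∑ j ∈ Finset.range (q + 1), s ^ j • c j) (Ioc (t n) (t (n + 1)))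

/-- The jump `[v] = v⁺ - v⁻` at `s`. -/
def jump {X : Type*} [NormedAddCommGroup X] (v : ℝ → X) (s : ℝ) : X :=
  Function.rightLim v s - v s

/-! ### The bilinear form, the load and the two problems -/

/-- The bilinear form `B((u₁,u₂),(v₁,v₂))`. -/
def formB {d : ℕ} {Ω : Set (EuclideanSpace ℝ (Fin d))} (N : ℕ) (t : ℕ → ℝ)
    (u₁ u₂ v₁ v₂ : ℝ → H01 Ω) : ℝ :=
  (∑ n ∈ Finset.range N, ∫ s in (t n)..(t (n + 1)),
      (energy (deriv u₁ s) (v₁ s) - energy (u₂ s) (v₁ s)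
        + ⟪(deriv u₂ s).toL2, (v₂ s).toL2⟫_ℝ + energy (u₁ s) (v₂ s)))
    + (∑ n ∈ Finset.Ico 1 N,
      (energy (jump u₁ (t n)) (Function.rightLim v₁ (t n))
        + ⟪(jump u₂ (t n)).toL2, (Function.rightLim v₂ (t n)).toL2⟫_ℝ))
    + energy (Function.rightLim u₁ (t 0)) (Function.rightLim v₁ (t 0))
    + ⟪(Function.rightLim u₂ (t 0)).toL2, (Function.rightLim v₂ (t 0)).toL2⟫_ℝ

/-- The load functional `L((v₁,v₂))`. -/
def formL {d : ℕ} {Ω : Set (EuclideanSpace ℝ (Fin d))} (N : ℕ) (t : ℕ → ℝ)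
    (f : ℝ → L2 Ω) (u₀ v₀ : H01 Ω) (v₁ v₂ : ℝ → H01 Ω) : ℝ :=
  (∑ n ∈ Finset.range N, ∫ s in (t n)..(t (n + 1)), ⟪f s, (v₂ s).toL2⟫_ℝ)
    + energy u₀ (Function.rightLim v₁ (t 0))
    + ⟪v₀.toL2, (Function.rightLim v₂ (t 0)).toL2⟫_ℝ

/-- `(U₁, U₂)` is the dG(q) solution: it is piecewise polynomial of degree at most `q` with values
in `H₀¹(Ω)`, `B(U, V) = L(V)` for all such `V`, and `U₀⁻ = (u₀, v₀)`. -/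
structure IsDGSolution {d : ℕ} {Ω : Set (EuclideanSpace ℝ (Fin d))} (q N : ℕ) (t : ℕ → ℝ)
    (f : ℝ → L2 Ω) (u₀ v₀ : H01 Ω) (U₁ U₂ : ℝ → H01 Ω) : Prop where
  poly₁ : PiecewisePoly q N t U₁
  poly₂ : PiecewisePoly q N t U₂
  eq : ∀ V₁ V₂ : ℝ → H01 Ω, PiecewisePoly q N t V₁ → PiecewisePoly q N t V₂ →
    formB N t U₁ U₂ V₁ V₂ = formL N t f u₀ v₀ V₁ V₂
  init₁ : U₁ 0 = u₀
  init₂ : U₂ 0 = v₀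

/-- `(u₁, u₂)` is a solution of the continuous problem, of class `C^m` in time on each mesh
interval, `u₁` with values in `dom(A)` and `u₂` in `H₀¹(Ω)`: `B(u, v) = L(v)` for all piecewise
smooth `v` with values in `dom(A)`, and `u(0) = (u₀, v₀)`. -/
structure IsSolution {d : ℕ} {Ω : Set (EuclideanSpace ℝ (Fin d))} (m : WithTop ℕ∞) (N : ℕ)
    (t : ℕ → ℝ) (f : ℝ → L2 Ω) (u₀ v₀ : H01 Ω) (u₁ : ℝ → DomA Ω) (u₂ : ℝ → H01 Ω) : Prop where
  smooth₁ : PiecewiseContDiff m N t u₁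
  smooth₂ : PiecewiseContDiff m N t u₂
  eq : ∀ v₁ v₂ : ℝ → DomA Ω, PiecewiseContDiff ∞ N t v₁ → PiecewiseContDiff ∞ N t v₂ →
    formB N t (fun s => (u₁ s).toH01) u₂ (fun s => (v₁ s).toH01) (fun s => (v₂ s).toH01)
      = formL N t f u₀ v₀ (fun s => (v₁ s).toH01) (fun s => (v₂ s).toH01)
  init₁ : (u₁ 0).toH01 = u₀
  init₂ : u₂ 0 = v₀

/-! ### The norms through an eigenbasis -/

/-- The weak gradient of `v ∈ H₀¹(Ω)` satisfies `∫_Ω (∇v)·y ψ = -∫_Ω v ∂_y ψ` for all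
`ψ ∈ C_c^∞(Ω)` and all vectors `y`. -/
theorem H01.integral_grad {d : ℕ} {Ω : Set (EuclideanSpace ℝ (Fin d))} (v : H01 Ω)
    (ψ : EuclideanSpace ℝ (Fin d) → ℝ) (hψ : ContDiff ℝ ∞ ψ) (hc : HasCompactSupport ψ)
    (hs : tsupport ψ ⊆ Ω) (y : EuclideanSpace ℝ (Fin d)) :
    ∫ x in Ω, ⟪ψ x • y, v.grad x⟫_ℝ = -∫ x in Ω, fderiv ℝ ψ x y * v.toL2 x := by
  have hψ1 : ContDiff ℝ 1 ψ := hψ.of_le (by exact_mod_cast le_top)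
  have hcont : Continuous fun x => fderiv ℝ ψ x y :=
    (hψ1.continuous_fderiv one_ne_zero).clm_apply continuous_const
  have hcs : HasCompactSupport fun x => fderiv ℝ ψ x y := hc.fderiv_apply (𝕜 := ℝ) y
  have m1 : MemLp (fun x => ψ x • y) 2 (volume.restrict Ω) :=
    ((hψ.continuous.smul continuous_const).memLp_of_hasCompactSupport
      hc.smul_right).restrict Ω
  have m2 : MemLp (fun x => fderiv ℝ ψ x y) 2 (volume.restrict Ω) :=
    (hcont.memLp_of_hasCompactSupport hcs).restrict Ω
  have key : ∀ p ∈ H01Submodule Ω,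
      ⟪m1.toLp _, WithLp.snd p⟫_ℝ + ⟪m2.toLp _, WithLp.fst p⟫_ℝ = 0 := by
    have hcl : IsClosed {p : WithLp 2 (L2 Ω × L2Vec Ω) |
        ⟪m1.toLp _, WithLp.snd p⟫_ℝ + ⟪m2.toLp _, WithLp.fst p⟫_ℝ = 0} :=
      isClosed_eq ((continuous_const.inner (WithLp.continuous_snd _ _ _)).add
        (continuous_const.inner (WithLp.continuous_fst _ _ _))) continuous_const
    intro p hp
    refine closure_minimal ?_ hcl hp
    intro p hp
    induction hp using Submodule.span_induction with
    | mem p hp =>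
      obtain ⟨φ, h1, h2, h3, h4, h5⟩ := hp
      have hφ1 : ContDiff ℝ 1 φ := h1.of_le (by exact_mod_cast le_top)
      have hφc : Continuous fun x => fderiv ℝ φ x y :=
        (hφ1.continuous_fderiv one_ne_zero).clm_apply continuous_const
      have e1 : ⟪m1.toLp _, WithLp.snd p⟫_ℝ = ∫ x, ψ x * fderiv ℝ φ x y := by
        rw [L2.inner_def]
        trans ∫ x in Ω, ψ x * fderiv ℝ φ x y
        · refine integral_congr_ae ?_
          filter_upwards [h5, m1.coeFn_toLp] with x hx hx'
          rw [hx, hx', real_inner_smul_left, real_inner_comm, gradient,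
            InnerProductSpace.toDual_symm_apply]
        · refine setIntegral_eq_integral_of_forall_compl_eq_zero fun x hx => ?_
          rw [image_eq_zero_of_notMem_tsupport (fun h => hx (hs h)), zero_mul]
      have e2 : ⟪m2.toLp _, WithLp.fst p⟫_ℝ = ∫ x, fderiv ℝ ψ x y * φ x := by
        rw [L2.inner_def]
        trans ∫ x in Ω, fderiv ℝ ψ x y * φ x
        · refine integral_congr_ae ?_
          filter_upwards [h4, m2.coeFn_toLp] with x hx hx'
          rw [hx, hx']
          simp [mul_comm]
        · refine setIntegral_eq_integral_of_forall_compl_eq_zero fun x hx => ?_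
          rw [image_eq_zero_of_notMem_tsupport (fun h => hx (h3 h)), mul_zero]
      rw [Set.mem_ofPred_eq, e1, e2,
        integral_mul_fderiv_eq_neg_fderiv_mul_of_integrable
          ((hcont.mul h1.continuous).integrable_of_hasCompactSupport hcs.mul_right)
          ((hψ.continuous.mul hφc).integrable_of_hasCompactSupport hc.mul_right)
          ((hψ.continuous.mul h1.continuous).integrable_of_hasCompactSupport hc.mul_right)
          (fun x _ => hψ1.differentiable one_ne_zero x)
          (fun x _ => hφ1.differentiable one_ne_zero x)]
      ring
    | zero => simp
    | add p r _ _ hp hr =>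
      simp only [Set.mem_ofPred_eq, WithLp.add_fst, WithLp.add_snd, inner_add_right] at hp hr ⊢
      linarith
    | smul c p _ hp =>
      simp only [Set.mem_ofPred_eq, WithLp.smul_fst, WithLp.smul_snd,
        real_inner_smul_right] at hp ⊢
      rw [← mul_add, hp, mul_zero]
  have h := key v v.2
  have e1 : ⟪m1.toLp _, v.grad⟫_ℝ = ∫ x in Ω, ⟪ψ x • y, v.grad x⟫_ℝ := by
    rw [L2.inner_def]
    refine integral_congr_ae ?_
    filter_upwards [m1.coeFn_toLp] with x hx
    rw [hx]
  have e2 : ⟪m2.toLp _, v.toL2⟫_ℝ = ∫ x in Ω, fderiv ℝ ψ x y * v.toL2 x := by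
    rw [L2.inner_def]
    refine integral_congr_ae ?_
    filter_upwards [m2.coeFn_toLp] with x hx
    rw [hx]
    simp [mul_comm]
  rw [← e1, ← e2]
  exact eq_neg_of_add_eq_zero_left h

/-- An element of `H₀¹(Ω)` is determined by its underlying function. -/
theorem H01.eq_of_toL2_eq {d : ℕ} {Ω : Set (EuclideanSpace ℝ (Fin d))} (hΩ : IsOpen Ω)
    {v w : H01 Ω} (h : v.toL2 = w.toL2) : v = w := by
  have main : ∀ z : H01 Ω, z.toL2 = 0 → z.grad = 0 := by
    intro z hz
    have hloc : LocallyIntegrableOn (fun x => z.grad x) Ω volume :=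
      locallyIntegrableOn_of_locallyIntegrable_restrict
        ((Lp.memLp z.grad).locallyIntegrable (by norm_num))
    have h0 := hΩ.ae_eq_zero_of_integral_contDiff_smul_eq_zero hloc (fun ψ h1 h2 h3 => by
      have hint : Integrable (fun x => ψ x • z.grad x) (volume.restrict Ω) :=
        memLp_one_iff_integrable.1 <| MemLp.smul (Lp.memLp z.grad)
          ((h1.continuous.memLp_of_hasCompactSupport (p := 2) h2).restrict Ω)
      rw [← setIntegral_eq_integral_of_forall_compl_eq_zero (s := Ω) (fun x hx => by
        rw [image_eq_zero_of_notMem_tsupport (fun h => hx (h3 h)), zero_smul])]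
      refine ext_inner_left ℝ fun y => ?_
      rw [inner_zero_right, ← integral_inner hint]
      have h4 := z.integral_grad ψ h1 h2 h3 y
      have h5 : ∫ x in Ω, fderiv ℝ ψ x y * z.toL2 x = 0 := by
        rw [← integral_zero (EuclideanSpace ℝ (Fin d)) ℝ (μ := volume.restrict Ω)]
        refine integral_congr_ae ?_
        rw [hz]
        filter_upwards [Lp.coeFn_zero ℝ 2 (volume.restrict Ω)] with x hx
        rw [hx]
        simp
      rw [h5, neg_zero] at h4
      rw [← h4]
      refine integral_congr_ae (Filter.Eventually.of_forall fun x => ?_)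
      simp only [real_inner_smul_left, real_inner_smul_right])
    rw [Lp.eq_zero_iff_ae_eq_zero]
    exact (ae_restrict_iff' hΩ.measurableSet).2 h0
  have h1 : (v - w).toL2 = 0 := by
    rw [H01.toL2, Submodule.coe_sub, WithLp.sub_fst]
    exact sub_eq_zero.2 h
  have h2 := main (v - w) h1
  rw [← sub_eq_zero]
  apply Subtype.ext
  exact WithLp.ofLp_injective 2 (Prod.ext h1 h2)

/-- If `φ_k` is an orthonormal basis of `L²(Ω)` of eigenvectors of `A`, with eigenvalues `λ_k`,
then `‖v‖₂² = Σ λ_k² (v, φ_k)²` on `dom(A)`. -/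
theorem hasSum_norm2_sq {d : ℕ} {Ω : Set (EuclideanSpace ℝ (Fin d))} (b : HilbertBasis ℕ ℝ (L2 Ω))
    (z : ℕ → DomA Ω) (ev : ℕ → ℝ) (hz : ∀ k, (z k).toH01.toL2 = b k)
    (hA : ∀ k, (z k).lap = ev k • b k) (v : DomA Ω) :
    HasSum (fun k => ev k ^ 2 * ⟪v.toH01.toL2, b k⟫_ℝ ^ 2) (norm2 v ^ 2) := by
  have h := b.hasSum_inner_mul_inner v.lap v.lap
  rw [real_inner_self_eq_norm_sq] at h
  change HasSum _ (‖v.lap‖ ^ 2)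
  have hk : ∀ k, ⟪b k, v.lap⟫_ℝ = ev k * ⟪v.toH01.toL2, b k⟫_ℝ := by
    intro k
    have h1 : energy v.toH01 (z k).toH01 = ⟪v.lap, (z k).toH01.toL2⟫_ℝ := v.2 (z k).toH01
    have h2 : energy (z k).toH01 v.toH01 = ⟪(z k).lap, v.toH01.toL2⟫_ℝ := (z k).2 v.toH01
    rw [hz, energy, real_inner_comm] at h1
    rw [energy, h1, hA, real_inner_smul_left] at h2
    rw [real_inner_comm, h2, real_inner_comm]
  refine (congrArg (HasSum · _) (funext fun k => ?_)).mpr h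
  rw [real_inner_comm (b k) v.lap, hk]
  ring

/-- In the same situation `‖v‖₁² = Σ λ_k (v, φ_k)²` on `H₀¹(Ω)`. -/
theorem hasSum_norm1_sq {d : ℕ} {Ω : Set (EuclideanSpace ℝ (Fin d))} (hΩ : IsOpen Ω)
    (b : HilbertBasis ℕ ℝ (L2 Ω)) (z : ℕ → DomA Ω) (ev : ℕ → ℝ)
    (hz : ∀ k, (z k).toH01.toL2 = b k) (hA : ∀ k, (z k).lap = ev k • b k) (v : H01 Ω) :
    HasSum (fun k => ev k * ⟪v.toL2, b k⟫_ℝ ^ 2) (norm1 v ^ 2) := by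
  have hE : ∀ k (w : H01 Ω), energy (z k).toH01 w = ev k * ⟪b k, w.toL2⟫_ℝ := by
    intro k w
    have := (z k).2 w
    change energy (z k).toH01 w = ⟪(z k).lap, w.toL2⟫_ℝ at this
    rw [this, hA, real_inner_smul_left]
  have hI : ∀ v w : H01 Ω, ⟪v, w⟫_ℝ = ⟪v.toL2, w.toL2⟫_ℝ + energy v w := fun v w => rfl
  have hnn : ∀ k, 0 < 1 + ev k := by
    intro k
    have h1 := hE k (z k).toH01
    rw [hz, real_inner_self_eq_norm_sq, b.orthonormal.1 k] at h1
    have : 0 ≤ energy (z k).toH01 (z k).toH01 := real_inner_self_nonneg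
    linarith
  have hzw : ∀ k (w : H01 Ω), ⟪(z k).toH01, w⟫_ℝ = (1 + ev k) * ⟪b k, w.toL2⟫_ℝ := by
    intro k w
    rw [hI, hE, hz]
    ring
  set y : ℕ → H01 Ω := fun k => (√(1 + ev k))⁻¹ • (z k).toH01 with hy
  have hyw : ∀ k (w : H01 Ω), ⟪y k, w⟫_ℝ = √(1 + ev k) * ⟪b k, w.toL2⟫_ℝ := by
    intro k w
    have h0 : √(1 + ev k) ≠ 0 := (Real.sqrt_pos.2 (hnn k)).ne'
    change ⟪(√(1 + ev k))⁻¹ • (z k).toH01, w⟫_ℝ = _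
    refine (real_inner_smul_left (z k).toH01 w _).trans ?_
    rw [hzw]
    nth_rewrite 2 [← Real.mul_self_sqrt (hnn k).le]
    field_simp
  have hyL : ∀ k, (y k).toL2 = (√(1 + ev k))⁻¹ • b k := by
    intro k
    rw [← hz]
    rfl
  have hon : Orthonormal ℝ y := by
    rw [orthonormal_iff_ite]
    intro i j
    have h0 : √(1 + ev j) ≠ 0 := (Real.sqrt_pos.2 (hnn j)).ne'
    rw [hyw, hyL, real_inner_smul_right, orthonormal_iff_ite.1 b.orthonormal]
    split_ifs with h
    · subst h
      field_simp
    · simp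
  have : CompleteSpace (H01 Ω) := by
    unfold H01 H01Submodule
    infer_instance
  have hbot : (Submodule.span ℝ (range y))ᗮ = ⊥ := by
    rw [Submodule.eq_bot_iff]
    intro w hw
    refine H01.eq_of_toL2_eq hΩ ?_
    change w.toL2 = 0
    have hk : ∀ k, b.repr w.toL2 k = 0 := by
      intro k
      have h1 := Submodule.mem_orthogonal _ _ |>.1 hw (y k) (Submodule.subset_span ⟨k, rfl⟩)
      rw [hyw] at h1
      rw [b.repr_apply_apply]
      exact (mul_eq_zero.1 h1).resolve_left (Real.sqrt_pos.2 (hnn k)).ne'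
    apply b.repr.injective
    rw [map_zero]
    ext k
    simpa using hk k
  have h1 := (HilbertBasis.mkOfOrthogonalEqBot hon hbot).hasSum_inner_mul_inner v v
  have h2 := b.hasSum_inner_mul_inner v.toL2 v.toL2
  have h3 := h1.sub h2
  have e : ⟪v, v⟫_ℝ - ⟪v.toL2, v.toL2⟫_ℝ = norm1 v ^ 2 := by
    rw [hI, energy, real_inner_self_eq_norm_sq v.grad, norm1]
    ring
  rw [e] at h3
  refine (congrArg (HasSum · _) (funext fun k => ?_)).mpr h3
  rw [HilbertBasis.coe_mkOfOrthogonalEqBot, real_inner_comm (y k) v, hyw,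
    real_inner_comm (b k) v.toL2]
  have := Real.mul_self_sqrt (hnn k).le
  linear_combination (-⟪b k, v.toL2⟫_ℝ ^ 2) * this


end WaveDG

end

open WaveDG

/-! On each mesh interval, scaled to [0, 1], test with τ^j v, j ≤ q, and integrate by parts in time.
A function w then enters the first-order part only through w(1) and its moments of order below q,
and the skew part through its moments of order at most q (`stepForm`, `formB_bump`). The exact
solution satisfies the same relation for H₀¹-valued tests, because dom(A) is dense in H₀¹
(`stepForm_eq_stepForm`). Replace it by the polynomial that interpolates at 1 and keeps the moments
of order below q (`exists_projection`): the nodal error is unchanged, and the only defect is k times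
the skew form of the q-th moment of the projection error. Taylor's formula bounds that moment by the
integral of the (q+1)-st derivative, and scaling back supplies k^(q+1).

What remains is stability of one step with factor exactly 1 in front of the incoming error e
(`exists_norm_step_le`), so that summation over the steps creates no dependence on T. Let θ = Σ τ^i
c_i be the discrete error and G a bound for the data. Testing with θ itself kills the skew part and
gives |θ(1)|² ≤ |e|² + 2G Σ|c_i|. To bound the c_i by |e| + G, let ρ be the Radau polynomial of
degree q + 1 (ρ(0) = 1, ρ(1) = 0, orthogonal to degrees below q) and test with x = (θ - ρ θ(0))/τ.
The first-order part becomes (|x(1)|² + ∫|x|²)/2. The skew part vanishes: the q-th moment of ρ is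
paired with θ(0) and the top coefficient of x, which is a multiple of θ(0). Since the Hilbert matrix
is positive definite, ∫|x|² controls the coefficients of x, and these control the c_i.

The argument only needs a map S of the test functions that turns the first-order form into an inner
product (Jx, Jv) and keeps the other form skew. S = id gives the energy norm of (∇x₁, x₂) and the
first estimate; S = A⁻¹ in both components gives the norm of (x₁, ∇A⁻¹x₂), one order lower, and the
second. Poincaré's inequality and Lax–Milgram provide A⁻¹ (`exists_solutionOperator`). -/

namespace WaveDG

/-! ### Polynomials with prescribed moments -/

open Polynomial in
/-- A polynomial of degree less than `n` whose first `n` weighted moments vanish is zero. -/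
theorem eq_zero_of_moments_eq_zero {w : ℝ → ℝ} (hw : Continuous w)
    (hpos : ∀ τ ∈ Ioo (0 : ℝ) 1, 0 < w τ) {n : ℕ} {p : ℝ[X]} (hp : p.degree < n)
    (h : ∀ k < n, ∫ τ in (0 : ℝ)..1, w τ * p.eval τ * τ ^ k = 0) : p = 0 := by
  by_contra hp0
  have hn : p.natDegree < n := (natDegree_lt_iff_degree_lt hp0).2 hp
  have hc : Continuous fun τ => w τ * p.eval τ ^ 2 := by fun_prop
  -- Expanding one factor p in monomials writes the integral of w p² as a combination of the
  -- vanishing moments.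
  have h0 : ∫ τ in (0 : ℝ)..1, w τ * p.eval τ ^ 2 = 0 := by
    have e : ∀ τ, w τ * p.eval τ ^ 2
        = ∑ k ∈ Finset.range n, p.coeff k * (w τ * p.eval τ * τ ^ k) := by
      intro τ
      rw [sq, ← mul_assoc]
      nth_rewrite 2 [eval_eq_sum_range' hn]
      rw [Finset.mul_sum]
      exact Finset.sum_congr rfl fun k _ => by ring
    simp_rw [e]
    rw [intervalIntegral.integral_finsetSum fun k _ =>
      Continuous.intervalIntegrable (by fun_prop) _ _]
    refine Finset.sum_eq_zero fun k hk => ?_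
    rw [intervalIntegral.integral_const_mul, h k (Finset.mem_range.1 hk), mul_zero]
  refine hp0 (eq_zero_of_infinite_isRoot p ((Ioo_infinite (zero_lt_one' ℝ)).mono fun τ hτ => ?_))
  by_contra hr
  have hnn : Icc (0 : ℝ) 1 ⊆ {s | 0 ≤ w s} := by
    rw [← closure_Ioo zero_ne_one]
    exact closure_minimal (fun s hs => (hpos s hs).le) (isClosed_le continuous_const hw)
  have : 0 < ∫ τ in (0 : ℝ)..1, w τ * p.eval τ ^ 2 :=
    intervalIntegral.integral_pos zero_lt_one hc.continuousOn
      (fun s hs => mul_nonneg (hnn (Ioc_subset_Icc_self hs)) (sq_nonneg _))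
      ⟨τ, Ioo_subset_Icc_self hτ, mul_pos (hpos τ hτ) (sq_pos_of_ne_zero hr)⟩
  exact this.ne' h0

open Polynomial in
/-- Weighted moments can be prescribed. -/
theorem exists_moments_eq {w : ℝ → ℝ} (hw : Continuous w)
    (hpos : ∀ τ ∈ Ioo (0 : ℝ) 1, 0 < w τ) (n : ℕ) (m : ℕ → ℝ) :
    ∃ p : ℝ[X], p.degree < n ∧ ∀ k < n, ∫ τ in (0 : ℝ)..1, w τ * p.eval τ * τ ^ k = m k := by
  let Φ : degreeLT ℝ n →ₗ[ℝ] (Fin n → ℝ) :=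
    { toFun := fun p k => ∫ τ in (0 : ℝ)..1, w τ * (p : ℝ[X]).eval τ * τ ^ (k : ℕ)
      map_add' := fun p r => by
        ext k
        simp only [Submodule.coe_add, eval_add, mul_add, add_mul, Pi.add_apply]
        exact intervalIntegral.integral_add (Continuous.intervalIntegrable (by fun_prop) _ _)
          (Continuous.intervalIntegrable (by fun_prop) _ _)
      map_smul' := fun c p => by
        ext k
        simp only [Submodule.coe_smul, eval_smul, smul_eq_mul, Pi.smul_apply, RingHom.id_apply]
        rw [← intervalIntegral.integral_const_mul]
        congr 1
        ext τ
        ring }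
  -- In coordinates the moment map is an endomorphism of ℝⁿ, so injectivity gives surjectivity.
  have hinj : Function.Injective (Φ.comp (degreeLTEquiv ℝ n).symm.toLinearMap) := by
    refine Function.Injective.comp (g := Φ) ?_ (degreeLTEquiv ℝ n).symm.injective
    rw [← LinearMap.ker_eq_bot, LinearMap.ker_eq_bot']
    intro p hp
    exact Subtype.ext (eq_zero_of_moments_eq_zero hw hpos (mem_degreeLT.1 p.2)
      fun k hk => congrFun hp ⟨k, hk⟩)
  obtain ⟨c, hc⟩ := LinearMap.injective_iff_surjective.1 hinj fun k => m k
  exact ⟨_, mem_degreeLT.1 ((degreeLTEquiv ℝ n).symm c).2, fun k hk => congrFun hc ⟨k, hk⟩⟩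

theorem integral_pow_zero_one (n : ℕ) : ∫ τ in (0 : ℝ)..1, τ ^ n = 1 / ((n : ℝ) + 1) := by
  simp [integral_pow]

open Polynomial in
theorem integral_eval_mul_pow {n : ℕ} {p : ℝ[X]} (hp : p.degree < n) (k : ℕ) :
    ∫ τ in (0 : ℝ)..1, p.eval τ * τ ^ k
      = ∑ j ∈ Finset.range n, p.coeff j / ((j : ℝ) + k + 1) := by
  rcases eq_or_ne p 0 with rfl | h0
  · simp
  simp_rw [eval_eq_sum_range' ((natDegree_lt_iff_degree_lt h0).2 hp), Finset.sum_mul, mul_assoc,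
    ← pow_add]
  rw [intervalIntegral.integral_finsetSum fun k _ =>
    Continuous.intervalIntegrable (by fun_prop) _ _]
  refine Finset.sum_congr rfl fun j _ => ?_
  rw [intervalIntegral.integral_const_mul, integral_pow_zero_one]
  push_cast
  ring

/-! ### Definiteness of the Hilbert matrix -/

/-- The Hilbert matrix is positive semidefinite. -/
theorem sum_inner_div_nonneg {Y : Type*} [NormedAddCommGroup Y] [InnerProductSpace ℝ Y]
    (n : ℕ) (y : ℕ → Y) :
    0 ≤ ∑ i ∈ Finset.range n, ∑ j ∈ Finset.range n, ⟪y i, y j⟫_ℝ / ((i : ℝ) + j + 1) := by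
  have e : ∑ i ∈ Finset.range n, ∑ j ∈ Finset.range n, ⟪y i, y j⟫_ℝ / ((i : ℝ) + j + 1)
      = ∫ τ in (0 : ℝ)..1, ‖∑ i ∈ Finset.range n, τ ^ i • y i‖ ^ 2 := by
    have e1 : ∀ τ : ℝ, ‖∑ i ∈ Finset.range n, τ ^ i • y i‖ ^ 2
        = ∑ i ∈ Finset.range n, ∑ j ∈ Finset.range n, ⟪y i, y j⟫_ℝ * τ ^ (i + j) := by
      intro τ
      rw [← real_inner_self_eq_norm_sq, sum_inner]
      refine Finset.sum_congr rfl fun i _ => ?_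
      rw [inner_sum]
      refine Finset.sum_congr rfl fun j _ => ?_
      rw [real_inner_smul_left, real_inner_smul_right]
      ring
    simp_rw [e1]
    rw [intervalIntegral.integral_finsetSum fun k _ =>
      Continuous.intervalIntegrable (by fun_prop) _ _]
    refine Finset.sum_congr rfl fun i _ => ?_
    rw [intervalIntegral.integral_finsetSum fun k _ =>
      Continuous.intervalIntegrable (by fun_prop) _ _]
    refine Finset.sum_congr rfl fun j _ => ?_
    rw [intervalIntegral.integral_const_mul, integral_pow_zero_one]
    push_cast
    ring
  rw [e]
  exact intervalIntegral.integral_nonneg zero_le_one fun τ _ => by positivity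

open Polynomial in
/-- The Hilbert matrix is positive definite, uniformly over all inner product spaces. -/
theorem exists_norm_sq_le_sum_inner_div (n : ℕ) : ∃ K : ℝ, 0 < K ∧
    ∀ {Y : Type*} [NormedAddCommGroup Y] [InnerProductSpace ℝ Y] (y : ℕ → Y), ∀ l < n,
      ‖y l‖ ^ 2 ≤ K *
        ∑ i ∈ Finset.range n, ∑ j ∈ Finset.range n, ⟪y i, y j⟫_ℝ / ((i : ℝ) + j + 1) := by
  -- Row l of the inverse Hilbert matrix, as the coefficients of the polynomial dual to τ^l. Being
  -- scalar, it serves every space Y at once.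
  have hd : ∀ l : ℕ, ∃ b : ℕ → ℝ, ∀ k < n,
      ∑ j ∈ Finset.range n, b j / ((j : ℝ) + k + 1) = if k = l then 1 else 0 := by
    intro l
    obtain ⟨p, hp, h⟩ := exists_moments_eq (w := fun _ => 1) continuous_const
      (fun _ _ => zero_lt_one) n (fun k => if k = l then 1 else 0)
    refine ⟨p.coeff, fun k hk => ?_⟩
    rw [← integral_eval_mul_pow hp, ← h k hk]
    simp
  choose b hb using hd
  refine ⟨∑ l ∈ Finset.range n, |b l l| + 1, by positivity, fun {Y} _ _ y l hl => ?_⟩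
  set Q := ∑ i ∈ Finset.range n, ∑ j ∈ Finset.range n, ⟪y i, y j⟫_ℝ / ((i : ℝ) + j + 1) with hQ
  have hQ0 : 0 ≤ Q := sum_inner_div_nonneg n y
  -- The nonnegative form evaluated at y - s (b_l ⊗ y_l); duality collapses the cross terms to
  -- ‖y_l‖².
  have key : ∀ s : ℝ, 0 ≤ Q - 2 * s * ‖y l‖ ^ 2 + s ^ 2 * b l l * ‖y l‖ ^ 2 := by
    intro s
    have h1 : ∑ i ∈ Finset.range n, ∑ j ∈ Finset.range n,
        b l i / ((i : ℝ) + j + 1) * ⟪y j, y l⟫_ℝ = ‖y l‖ ^ 2 := by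
      rw [Finset.sum_comm]
      simp_rw [← Finset.sum_mul]
      rw [Finset.sum_congr rfl fun k hk => by rw [hb l k (Finset.mem_range.1 hk)]]
      simp [hl]
    have h2 : ∑ i ∈ Finset.range n, ∑ j ∈ Finset.range n,
        b l i / ((i : ℝ) + j + 1) * b l j = b l l := by
      rw [Finset.sum_comm]
      simp_rw [← Finset.sum_mul]
      rw [Finset.sum_congr rfl fun k hk => by rw [hb l k (Finset.mem_range.1 hk)]]
      simp [hl]
    have h1' : ∑ i ∈ Finset.range n, ∑ j ∈ Finset.range n,
        b l j / ((i : ℝ) + j + 1) * ⟪y i, y l⟫_ℝ = ‖y l‖ ^ 2 := by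
      rw [← h1, Finset.sum_comm]
      exact Finset.sum_congr rfl fun i _ => Finset.sum_congr rfl fun j _ => by
        rw [add_comm (i : ℝ)]
    have h := sum_inner_div_nonneg n fun i => y i - (s * b l i) • y l
    have e : ∀ i j : ℕ, ⟪y i - (s * b l i) • y l, y j - (s * b l j) • y l⟫_ℝ / ((i : ℝ) + j + 1)
        = ⟪y i, y j⟫_ℝ / ((i : ℝ) + j + 1)
          - s * (b l i / ((i : ℝ) + j + 1) * ⟪y j, y l⟫_ℝ)
          - s * (b l j / ((i : ℝ) + j + 1) * ⟪y i, y l⟫_ℝ)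
          + s ^ 2 * (b l i / ((i : ℝ) + j + 1) * b l j) * ‖y l‖ ^ 2 := by
      intro i j
      rw [inner_sub_left, inner_sub_right, inner_sub_right, real_inner_smul_left,
        real_inner_smul_right, real_inner_smul_left, real_inner_smul_right,
        real_inner_self_eq_norm_sq, real_inner_comm (y j) (y l)]
      ring
    simp_rw [e, Finset.sum_add_distrib, Finset.sum_sub_distrib, ← Finset.sum_mul,
      ← Finset.mul_sum] at h
    rw [h1, h1', h2] at h
    linarith
  set B := ∑ l ∈ Finset.range n, |b l l| + 1 with hB
  have hBl : b l l ≤ B - 1 := by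
    have := Finset.single_le_sum (f := fun l => |b l l|) (fun i _ => abs_nonneg _)
      (Finset.mem_range.2 hl)
    have h2 := le_abs_self (b l l)
    linarith
  have hB0 : 0 < B := by positivity
  -- Since b_ll ≤ B, the choice s = 1/B makes the quadratic term at most half of the linear one,
  -- which leaves ‖y_l‖² ≤ B Q.
  have h := key B⁻¹
  have hy := sq_nonneg ‖y l‖
  have h3 : B * (Q - 2 * B⁻¹ * ‖y l‖ ^ 2 + B⁻¹ ^ 2 * b l l * ‖y l‖ ^ 2)
      = B * Q - 2 * ‖y l‖ ^ 2 + B⁻¹ * b l l * ‖y l‖ ^ 2 := by field_simp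
  have h4 : B⁻¹ * b l l ≤ 1 := by
    rw [inv_mul_le_iff₀ hB0]
    linarith
  have h5 := mul_nonneg hB0.le h
  have h6 := mul_le_mul_of_nonneg_right h4 hy
  linarith

/-! ### The Radau polynomial -/

open Polynomial in
/-- Coefficients of the Radau polynomial `ρ` of degree `q + 1`, normalised by `ρ(0) = 1`: it
vanishes at `1` and is orthogonal to all polynomials of degree less than `q`. -/
theorem exists_radau (q : ℕ) : ∃ ρ : ℕ → ℝ, ρ 0 = 1 ∧ ρ (q + 1) ≠ 0 ∧
    ∑ i ∈ Finset.range (q + 2), ρ i = 0 ∧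
    ∀ k < q, ∑ i ∈ Finset.range (q + 2), ρ i / ((i : ℝ) + k + 1) = 0 := by
  -- The ansatz ρ = (1 - τ) s with s = 1 - τ r builds in ρ(1) = 0 and ρ(0) = 1; orthogonality of ρ
  -- then prescribes the moments of r for the weight (1 - τ) τ.
  obtain ⟨r, hr, hm⟩ := exists_moments_eq (w := fun τ => (1 - τ) * τ) (by fun_prop)
    (fun τ hτ => mul_pos (sub_pos.2 hτ.2) hτ.1) q
    (fun k => ∫ τ in (0 : ℝ)..1, (1 - τ) * τ ^ k)
  set s : ℝ[X] := 1 - X * r with hs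
  have hXr : (X * r).degree ≤ (q : WithBot ℕ) := by
    rcases eq_or_ne r 0 with rfl | h0
    · simp
    rw [degree_mul, degree_X, degree_eq_natDegree h0]
    have := (natDegree_lt_iff_degree_lt h0).2 hr
    exact_mod_cast (by omega : 1 + r.natDegree ≤ q)
  have hsd : s.degree ≤ (q : WithBot ℕ) := (degree_sub_le _ _).trans
    (max_le (degree_one_le.trans (by exact_mod_cast Nat.zero_le q)) hXr)
  have hs0 : s.coeff 0 = 1 := by simp [hs]
  have horth : ∀ k < q, ∫ τ in (0 : ℝ)..1, (1 - τ) * s.eval τ * τ ^ k = 0 := by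
    intro k hk
    have h := hm k hk
    rw [← sub_eq_zero, ← intervalIntegral.integral_sub
      (Continuous.intervalIntegrable (by fun_prop) _ _)
      (Continuous.intervalIntegrable (by fun_prop) _ _)] at h
    rw [← neg_eq_zero, ← intervalIntegral.integral_neg, ← h]
    congr 1
    ext τ
    simp only [hs, eval_sub, eval_one, eval_mul, eval_X]
    ring
  -- If the top coefficient vanished, s would have degree below q and be orthogonal, with weight 1 -
  -- τ, to all such polynomials; hence s = 0, against s(0) = 1.
  have hsq : s.coeff q ≠ 0 := by
    intro h
    have : s = 0 := by
      refine eq_zero_of_moments_eq_zero (w := fun τ => 1 - τ) (by fun_prop)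
        (fun τ hτ => sub_pos.2 hτ.2) (n := q) ?_ horth
      refine lt_of_le_of_ne hsd fun hd => ?_
      exact coeff_ne_zero_of_eq_degree hd h
    rw [this] at hs0
    simp at hs0
  have hP : ((1 - X) * s).degree < ((q + 2 : ℕ) : WithBot ℕ) := by
    refine (degree_mul_le _ _).trans_lt ?_
    have h1 : (1 - X : ℝ[X]).degree ≤ 1 := (degree_sub_le _ _).trans
      (max_le (degree_one_le.trans zero_le_one) degree_X_le)
    refine (add_le_add h1 hsd).trans_lt ?_
    exact_mod_cast (by omega : 1 + q < q + 2)
  refine ⟨((1 - X) * s).coeff, ?_, ?_, ?_, fun k hk => ?_⟩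
  · simp [hs0]
  · have : s.coeff (q + 1) = 0 :=
      coeff_eq_zero_of_degree_lt (hsd.trans_lt (by exact_mod_cast Nat.lt_succ_self q))
    simp [sub_mul, coeff_X_mul, this, hsq]
  · have h : ((1 - X) * s).eval 1 = 0 := by simp
    rcases eq_or_ne ((1 - X) * s) 0 with h0 | h0
    · simp [h0]
    rw [eval_eq_sum_range' ((natDegree_lt_iff_degree_lt h0).2 hP)] at h
    simpa using h
  · rw [← integral_eval_mul_pow hP]
    refine Eq.trans ?_ (horth k hk)
    simp


/-! ### Stability of one time step -/

/-- Energy identity for a polynomial `Σ τ^i c_i` tested with itself. -/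
theorem sum_inner_self_eq {Y : Type*} [NormedAddCommGroup Y] [InnerProductSpace ℝ Y]
    (n : ℕ) (y : ℕ → Y) :
    ∑ j ∈ Finset.range (n + 1),
      ⟪∑ i ∈ Finset.range (n + 1), (1 - (j : ℝ) / ((i : ℝ) + j)) • y i, y j⟫_ℝ
      = (‖∑ i ∈ Finset.range (n + 1), y i‖ ^ 2 + ‖y 0‖ ^ 2) / 2 := by
  have h1 : ∑ j ∈ Finset.range (n + 1),
      ⟪∑ i ∈ Finset.range (n + 1), (1 - (j : ℝ) / ((i : ℝ) + j)) • y i, y j⟫_ℝ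
      = ∑ j ∈ Finset.range (n + 1), ∑ i ∈ Finset.range (n + 1),
        (1 - (j : ℝ) / ((i : ℝ) + j)) * ⟪y i, y j⟫_ℝ := by
    simp_rw [sum_inner, real_inner_smul_left]
  have h2 : ∑ j ∈ Finset.range (n + 1), ∑ i ∈ Finset.range (n + 1),
        (1 - (j : ℝ) / ((i : ℝ) + j)) * ⟪y i, y j⟫_ℝ
      = ∑ j ∈ Finset.range (n + 1), ∑ i ∈ Finset.range (n + 1),
        (1 - (i : ℝ) / ((i : ℝ) + j)) * ⟪y i, y j⟫_ℝ := by
    rw [Finset.sum_comm]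
    refine Finset.sum_congr rfl fun j _ => Finset.sum_congr rfl fun i _ => ?_
    rw [real_inner_comm, add_comm (i : ℝ)]
  have h3 : ‖∑ i ∈ Finset.range (n + 1), y i‖ ^ 2
      = ∑ j ∈ Finset.range (n + 1), ∑ i ∈ Finset.range (n + 1), ⟪y i, y j⟫_ℝ := by
    rw [← real_inner_self_eq_norm_sq, inner_sum]
    simp_rw [sum_inner]
  have h4 : ‖y 0‖ ^ 2 = ∑ j ∈ Finset.range (n + 1), ∑ i ∈ Finset.range (n + 1),
      if i = 0 ∧ j = 0 then ⟪y i, y j⟫_ℝ else 0 := by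
    simp_rw [ite_and]
    simp
  rw [eq_div_iff two_ne_zero, mul_two]
  nth_rewrite 2 [h1]
  rw [h1, h2, h3, h4, ← h2]
  nth_rewrite 2 [h2]
  simp_rw [← Finset.sum_add_distrib]
  refine Finset.sum_congr rfl fun j _ => Finset.sum_congr rfl fun i _ => ?_
  -- The two symmetrised coefficients add up to 1, except for i = j = 0: there 0/0 is read as 0, the
  -- sum is 2, and the surplus is ‖y 0‖², the contribution of the jump.
  split_ifs with h
  · obtain ⟨rfl, rfl⟩ := h
    simp
  · have : (i : ℝ) + j ≠ 0 := by
      norm_cast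
      omega
    field_simp
    ring

/-- The identity behind the `L∞` stability of the method: the polynomial `Σ τ^i c_i`, with
`c_{i+1} = x_i + ρ_{i+1} c_0`, tested with `Σ τ^j x_j`. -/
theorem sum_inner_radau_eq {Y : Type*} [NormedAddCommGroup Y] [InnerProductSpace ℝ Y]
    (q : ℕ) (ρ : ℕ → ℝ) (h0 : ρ 0 = 1) (h1 : ∑ i ∈ Finset.range (q + 2), ρ i = 0)
    (hm : ∀ k < q, ∑ i ∈ Finset.range (q + 2), ρ i / ((i : ℝ) + k + 1) = 0)
    (x y : ℕ → Y) (hy : ∀ i, y (i + 1) = x i + ρ (i + 1) • y 0) :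
    ∑ j ∈ Finset.range (q + 1),
      ⟪∑ i ∈ Finset.range (q + 2), (1 - (j : ℝ) / ((i : ℝ) + j)) • y i, x j⟫_ℝ
      = (‖∑ i ∈ Finset.range (q + 1), x i‖ ^ 2
        + ∑ i ∈ Finset.range (q + 1), ∑ j ∈ Finset.range (q + 1),
          ⟪x i, x j⟫_ℝ / ((i : ℝ) + j + 1)) / 2 := by
  have hsum : ∀ j ∈ Finset.range (q + 1),
      ∑ i ∈ Finset.range (q + 2), (1 - (j : ℝ) / ((i : ℝ) + j)) • y i
      = ∑ i ∈ Finset.range (q + 1), (1 - (j : ℝ) / ((i : ℝ) + 1 + j)) • x i := by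
    intro j hj
    -- The coefficients of row j encode p(1) - j ∫ τ^(j-1) p. For p = ρ both parts vanish, as j - 1
    -- < q, so the multiple of y 0 drops out.
    have e : ∑ i ∈ Finset.range (q + 2), (1 - (j : ℝ) / ((i : ℝ) + j)) * ρ i = 0 := by
      simp_rw [sub_mul, one_mul, Finset.sum_sub_distrib, h1]
      rcases j with _ | j
      · simp
      · have h := hm j (by simpa using hj)
        rw [zero_sub, neg_eq_zero, ← mul_zero ((j : ℝ) + 1), ← h, Finset.mul_sum]
        refine Finset.sum_congr rfl fun i _ => ?_
        push_cast
        ring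
    have e2 : ∑ i ∈ Finset.range (q + 2), (1 - (j : ℝ) / ((i : ℝ) + j)) • y i
        = ∑ i ∈ Finset.range (q + 1), (1 - (j : ℝ) / ((i : ℝ) + 1 + j)) • x i
        + (∑ i ∈ Finset.range (q + 2), (1 - (j : ℝ) / ((i : ℝ) + j)) * ρ i) • y 0 := by
      rw [Finset.sum_range_succ', Finset.sum_range_succ' _ (q + 1), add_smul, Finset.sum_smul,
        ← add_assoc, ← Finset.sum_add_distrib, h0, mul_one]
      congr 1
      refine Finset.sum_congr rfl fun i _ => ?_
      rw [hy, smul_add, smul_smul]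
      push_cast
      rfl
    rw [e2, e, zero_smul, add_zero]
  rw [Finset.sum_congr rfl fun j hj => by rw [hsum j hj]]
  have e1 : ∑ j ∈ Finset.range (q + 1),
      ⟪∑ i ∈ Finset.range (q + 1), (1 - (j : ℝ) / ((i : ℝ) + 1 + j)) • x i, x j⟫_ℝ
      = ∑ j ∈ Finset.range (q + 1), ∑ i ∈ Finset.range (q + 1),
        (1 - (j : ℝ) / ((i : ℝ) + 1 + j)) * ⟪x i, x j⟫_ℝ := by
    simp_rw [sum_inner, real_inner_smul_left]
  have e2 : ∑ j ∈ Finset.range (q + 1), ∑ i ∈ Finset.range (q + 1),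
        (1 - (j : ℝ) / ((i : ℝ) + 1 + j)) * ⟪x i, x j⟫_ℝ
      = ∑ j ∈ Finset.range (q + 1), ∑ i ∈ Finset.range (q + 1),
        (1 - (i : ℝ) / ((i : ℝ) + 1 + j)) * ⟪x i, x j⟫_ℝ := by
    rw [Finset.sum_comm]
    refine Finset.sum_congr rfl fun j _ => Finset.sum_congr rfl fun i _ => ?_
    rw [real_inner_comm, add_right_comm (i : ℝ), add_comm (i : ℝ), add_right_comm (j : ℝ)]
  have e3 : ‖∑ i ∈ Finset.range (q + 1), x i‖ ^ 2
      = ∑ j ∈ Finset.range (q + 1), ∑ i ∈ Finset.range (q + 1), ⟪x i, x j⟫_ℝ := by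
    rw [← real_inner_self_eq_norm_sq, inner_sum]
    simp_rw [sum_inner]
  rw [e1, eq_div_iff two_ne_zero, mul_two]
  nth_rewrite 2 [e2]
  rw [e3, Finset.sum_comm (f := fun i j => ⟪x i, x j⟫_ℝ / ((i : ℝ) + j + 1))]
  simp_rw [← Finset.sum_add_distrib]
  refine Finset.sum_congr rfl fun j _ => Finset.sum_congr rfl fun i _ => ?_
  -- The symmetrised coefficients add up to 2 - (i + j)/(i + j + 1) = 1 + 1/(i + j + 1).
  have : (i : ℝ) + 1 + j ≠ 0 := by positivity
  have : (i : ℝ) + j + 1 ≠ 0 := by positivity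
  field_simp
  ring

/-- An alternating form is antisymmetric, so interchanging i and j changes the sign of the sum. -/
theorem sum_skew_eq_zero {E : Type*} [AddCommGroup E] [Module ℝ E] {ℓ : E →ₗ[ℝ] E →ₗ[ℝ] ℝ}
    (hℓ : ∀ x, ℓ x x = 0) (s : Finset ℕ) (a : ℕ → ℕ → ℝ) (ha : ∀ i j, a i j = a j i) (x : ℕ → E) :
    ∑ j ∈ s, ∑ i ∈ s, a i j * ℓ (x i) (x j) = 0 := by
  have hs : ∀ u v, ℓ u v = -ℓ v u := by
    intro u v
    have h := hℓ (u + v)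
    simp only [map_add, LinearMap.add_apply, hℓ] at h
    linarith
  have h : ∑ j ∈ s, ∑ i ∈ s, a i j * ℓ (x i) (x j) = -∑ j ∈ s, ∑ i ∈ s, a i j * ℓ (x i) (x j) := by
    nth_rewrite 1 [Finset.sum_comm]
    simp_rw [← Finset.sum_neg_distrib]
    refine Finset.sum_congr rfl fun j _ => Finset.sum_congr rfl fun i _ => ?_
    rw [ha, hs, mul_neg]
  linarith

/-- One time step of the method, for a skew-symmetric form `ℓ` and the semi-norm `‖J ·‖`: with
data `F` bounded by `G`, the semi-norm at the end of the step exceeds the one at its start by at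
most `C G`, where `C` depends on the degree only. -/
theorem exists_norm_step_le.{u, v} (q : ℕ) : ∃ C : ℝ, 0 < C ∧
    ∀ {E : Type u} {Y : Type v} [AddCommGroup E] [Module ℝ E]
      [NormedAddCommGroup Y] [InnerProductSpace ℝ Y]
      (J : E →ₗ[ℝ] Y) (ℓ : E →ₗ[ℝ] E →ₗ[ℝ] ℝ) (_ : ∀ x, ℓ x x = 0) (c : ℕ → E) (x₀ : E)
      (F : ℕ → E → ℝ) (G : ℝ) (_ : 0 ≤ G)
      (_ : ∀ j ∈ Finset.range (q + 1), ∀ v, |F j v| ≤ G * ‖J v‖)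
      (_ : ∀ j ∈ Finset.range (q + 1), ∀ v,
        ⟪J (∑ i ∈ Finset.range (q + 1), (1 - (j : ℝ) / ((i : ℝ) + j)) • c i), J v⟫_ℝ
          + ℓ (∑ i ∈ Finset.range (q + 1), (1 / ((i : ℝ) + j + 1)) • c i) v
          = (if j = 0 then ⟪J x₀, J v⟫_ℝ else 0) + F j v),
      ‖J (∑ i ∈ Finset.range (q + 1), c i)‖ ≤ ‖J x₀‖ + C * G := by
  obtain ⟨ρ, h0, hq, h1, hm⟩ := exists_radau q
  obtain ⟨K, hK, hcoer⟩ := exists_norm_sq_le_sum_inner_div.{v} (q + 1)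
  set K₁ : ℝ := 2 * (q + 1) ^ 2 * K with hK₁
  set R : ℝ := 1 + ∑ i ∈ Finset.range q, |ρ (i + 1)| with hR
  have hR0 : 0 ≤ R := by positivity
  set K₂ : ℝ := 1 + R / |ρ (q + 1)| with hK₂
  have hK₂0 : 0 ≤ K₂ := by positivity
  refine ⟨K₂ * K₁ + 1, by positivity, ?_⟩
  intro E Y _ _ _ _ J ℓ hℓ c' x₀ F G hG hF h
  -- extend the coefficients by zero
  obtain ⟨c, hcq, hc⟩ : ∃ c : ℕ → E, c (q + 1) = 0 ∧ ∀ i ∈ Finset.range (q + 1), c' i = c i :=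
    ⟨fun i => if i < q + 1 then c' i else 0, by simp, fun i hi => by
      simp [Finset.mem_range.1 hi]⟩
  have hsc : ∀ a : ℕ → ℝ, ∑ i ∈ Finset.range (q + 1), a i • c' i
      = ∑ i ∈ Finset.range (q + 1), a i • c i := fun a =>
    Finset.sum_congr rfl fun i hi => by rw [hc i hi]
  rw [Finset.sum_congr rfl hc]
  simp only [hsc] at h
  have test : ∀ v : ℕ → E,
      ∑ j ∈ Finset.range (q + 1),
        ⟪∑ i ∈ Finset.range (q + 1), (1 - (j : ℝ) / ((i : ℝ) + j)) • J (c i), J (v j)⟫_ℝ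
      + ∑ j ∈ Finset.range (q + 1), ∑ i ∈ Finset.range (q + 1),
        1 / ((i : ℝ) + j + 1) * ℓ (c i) (v j)
      = ⟪J x₀, J (v 0)⟫_ℝ + ∑ j ∈ Finset.range (q + 1), F j (v j) := by
    intro v
    have h' := Finset.sum_congr rfl fun j hj => h j hj (v j)
    rw [Finset.sum_add_distrib, Finset.sum_add_distrib] at h'
    simpa [map_sum, LinearMap.sum_apply] using h'
  have hFv : ∀ v : ℕ → E, ∑ j ∈ Finset.range (q + 1), F j (v j)
      ≤ G * ∑ j ∈ Finset.range (q + 1), ‖J (v j)‖ := by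
    intro v
    rw [Finset.mul_sum]
    exact Finset.sum_le_sum fun j hj => (le_abs_self _).trans (hF j hj _)
  -- testing with the solution itself
  have energyId := test c
  rw [sum_inner_self_eq q fun i => J (c i),
    sum_skew_eq_zero hℓ _ (fun i j => 1 / ((i : ℝ) + j + 1)) (fun i j => by rw [add_comm (i : ℝ)]),
    add_zero] at energyId
  -- testing with the Radau quotient
  set x : ℕ → E := fun i => c (i + 1) - ρ (i + 1) • c 0 with hx
  have hcx : ∀ i, c (i + 1) = x i + ρ (i + 1) • c 0 := fun i => by simp [hx]
  -- With θ = τ x + ρ c_0 the factor τ shifts the weight to 1/(i + j + 2), still symmetric in i and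
  -- j, and ρ contributes only its moments.
  have hext : ∀ j ∈ Finset.range (q + 1),
      ∑ i ∈ Finset.range (q + 1), 1 / ((i : ℝ) + j + 1) * ℓ (c i) (x j)
      = ∑ i ∈ Finset.range (q + 1), 1 / ((i : ℝ) + j + 2) * ℓ (x i) (x j) := by
    intro j hj
    have e1 : ∑ i ∈ Finset.range (q + 1), 1 / ((i : ℝ) + j + 1) * ℓ (c i) (x j)
        = ∑ i ∈ Finset.range (q + 2), 1 / ((i : ℝ) + j + 1) * ℓ (c i) (x j) := by
      rw [Finset.sum_range_succ _ (q + 1), hcq]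
      simp
    have e2 : ∑ i ∈ Finset.range (q + 2), 1 / ((i : ℝ) + j + 1) * ℓ (c i) (x j)
        = ∑ i ∈ Finset.range (q + 1), 1 / ((i : ℝ) + j + 2) * ℓ (x i) (x j)
          + (∑ i ∈ Finset.range (q + 2), ρ i / ((i : ℝ) + j + 1)) * ℓ (c 0) (x j) := by
      rw [Finset.sum_range_succ', Finset.sum_range_succ' _ (q + 1), add_mul, Finset.sum_mul,
        ← add_assoc, ← Finset.sum_add_distrib, h0]
      congr 1
      refine Finset.sum_congr rfl fun i _ => ?_
      rw [hcx, map_add, map_smul, LinearMap.add_apply, LinearMap.smul_apply, smul_eq_mul]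
      push_cast
      ring
    rw [e1, e2, add_eq_left]
    -- For j < q the moment of ρ vanishes. For j = q it need not, but x_q = -ρ_{q+1} c_0, since
    -- c_{q+1} = 0, so the skew form vanishes.
    rcases (Nat.lt_succ_iff.1 (Finset.mem_range.1 hj)).lt_or_eq with hjq | rfl
    · rw [hm j hjq, zero_mul]
    · simp [hx, hcq, hℓ]
  have radauId := test x
  rw [Finset.sum_congr rfl hext,
    sum_skew_eq_zero hℓ _ (fun i j => 1 / ((i : ℝ) + j + 2)) (fun i j => by rw [add_comm (i : ℝ)]),
    add_zero] at radauId
  have hrad := sum_inner_radau_eq q ρ h0 h1 hm (fun i => J (x i)) (fun i => J (c i))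
    fun i => by simp only [hcx i, map_add, map_smul]
  have hext2 : ∀ j : ℕ, ∑ i ∈ Finset.range (q + 2), (1 - (j : ℝ) / ((i : ℝ) + j)) • J (c i)
      = ∑ i ∈ Finset.range (q + 1), (1 - (j : ℝ) / ((i : ℝ) + j)) • J (c i) := by
    intro j
    rw [Finset.sum_range_succ, hcq]
    simp
  simp_rw [hext2] at hrad
  rw [radauId] at hrad
  set Q := ∑ i ∈ Finset.range (q + 1), ∑ j ∈ Finset.range (q + 1),
    ⟪J (x i), J (x j)⟫_ℝ / ((i : ℝ) + j + 1) with hQ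
  set X := ∑ j ∈ Finset.range (q + 1), ‖J (x j)‖ with hX
  have hX0 : 0 ≤ X := by positivity
  have hle : ∀ j < q + 1, ‖J (x j)‖ ≤ X := fun j hj =>
    Finset.single_le_sum (f := fun j => ‖J (x j)‖) (fun i _ => norm_nonneg _)
      (Finset.mem_range.2 hj)
  -- Here ‖x(1)‖² is dropped; only the L² part Q is needed.
  have hQle : Q ≤ 2 * ((‖J x₀‖ + G) * X) := by
    have a1 := hFv x
    have a2 := (real_inner_le_norm (J x₀) (J (x 0))).trans
      (mul_le_mul_of_nonneg_left (hle 0 q.succ_pos) (norm_nonneg _))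
    have a3 := sq_nonneg ‖∑ i ∈ Finset.range (q + 1), J (x i)‖
    linarith
  have hXsq : X ^ 2 ≤ K₁ * (‖J x₀‖ + G) * X := by
    have a1 : X ^ 2 ≤ (q + 1 : ℝ) * ∑ j ∈ Finset.range (q + 1), ‖J (x j)‖ ^ 2 := by
      have := sq_sum_le_card_mul_sum_sq (s := Finset.range (q + 1)) (f := fun j => ‖J (x j)‖)
      simpa using this
    have a2 : ∑ j ∈ Finset.range (q + 1), ‖J (x j)‖ ^ 2 ≤ (q + 1 : ℝ) * (K * Q) := by
      refine (Finset.sum_le_sum fun j hj =>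
        hcoer (fun i => J (x i)) j (Finset.mem_range.1 hj)).trans_eq ?_
      simp [hQ]
    calc X ^ 2 ≤ (q + 1 : ℝ) * ((q + 1 : ℝ) * (K * Q)) :=
          a1.trans (mul_le_mul_of_nonneg_left a2 (by positivity))
      _ ≤ (q + 1 : ℝ) * ((q + 1 : ℝ) * (K * (2 * ((‖J x₀‖ + G) * X)))) := by gcongr
      _ = K₁ * (‖J x₀‖ + G) * X := by rw [hK₁]; ring
  have hXle : X ≤ K₁ * (‖J x₀‖ + G) := by
    rcases hX0.eq_or_lt with h | h
    · rw [← h]; positivity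
    · rw [sq] at hXsq
      exact le_of_mul_le_mul_right hXsq h
  have hρ : 0 < |ρ (q + 1)| := abs_pos.2 hq
  -- The starting value is read off from the top coefficient x_q = -ρ_{q+1} c_0; this is where
  -- ρ_{q+1} ≠ 0 is used.
  have hc0 : ‖J (c 0)‖ ≤ X / |ρ (q + 1)| := by
    rw [le_div_iff₀ hρ]
    have e : J (x q) = -(ρ (q + 1) • J (c 0)) := by simp [hx, hcq]
    have := hle q q.lt_succ_self
    rwa [e, norm_neg, norm_smul, Real.norm_eq_abs, mul_comm] at this
  have hW : ∑ j ∈ Finset.range (q + 1), ‖J (c j)‖ ≤ K₂ * X := by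
    have a1 : ∀ i ∈ Finset.range q, ‖J (c (i + 1))‖ ≤ ‖J (x i)‖ + |ρ (i + 1)| * ‖J (c 0)‖ := by
      intro i _
      rw [hcx, map_add, map_smul]
      exact (norm_add_le _ _).trans_eq (by rw [norm_smul, Real.norm_eq_abs])
    have a2 : ∑ i ∈ Finset.range q, ‖J (x i)‖ ≤ X :=
      Finset.sum_le_sum_of_subset_of_nonneg (Finset.range_mono q.le_succ)
        fun _ _ _ => norm_nonneg _
    calc ∑ j ∈ Finset.range (q + 1), ‖J (c j)‖
        = ∑ i ∈ Finset.range q, ‖J (c (i + 1))‖ + ‖J (c 0)‖ := Finset.sum_range_succ' _ _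
      _ ≤ ∑ i ∈ Finset.range q, (‖J (x i)‖ + |ρ (i + 1)| * ‖J (c 0)‖) + ‖J (c 0)‖ := by
          gcongr with i hi
          exact a1 i hi
      _ = ∑ i ∈ Finset.range q, ‖J (x i)‖ + R * ‖J (c 0)‖ := by
          rw [Finset.sum_add_distrib, hR, add_mul, Finset.sum_mul]
          ring
      _ ≤ X + R * (X / |ρ (q + 1)|) := by gcongr
      _ = K₂ * X := by rw [hK₂]; ring
  have hGW : G * ∑ j ∈ Finset.range (q + 1), ‖J (c j)‖
      ≤ K₂ * K₁ * G * (‖J x₀‖ + G) := by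
    calc G * ∑ j ∈ Finset.range (q + 1), ‖J (c j)‖ ≤ G * (K₂ * (K₁ * (‖J x₀‖ + G))) := by
          gcongr
          exact hW.trans (by gcongr)
      _ = _ := by ring
  -- Young's inequality on (J x₀, J c₀) produces ‖J c₀‖²/2, exactly the jump term of the energy
  -- identity, so ‖J x₀‖² keeps the factor 1.
  have hen : ‖J (∑ i ∈ Finset.range (q + 1), c i)‖ ^ 2
      ≤ ‖J x₀‖ ^ 2 + 2 * (K₂ * K₁ * G * (‖J x₀‖ + G)) := by
    have a1 := hFv c
    have a2 := real_inner_le_norm (J x₀) (J (c 0))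
    have a3 := sq_nonneg (‖J x₀‖ - ‖J (c 0)‖)
    rw [map_sum]
    linarith
  -- The right side is at most (‖J x₀‖ + (K₂ K₁ + 1) G)².
  refine (sq_le_sq₀ (norm_nonneg _) (by positivity)).1 (hen.trans ?_)
  have b1 : 0 ≤ G * ‖J x₀‖ := by positivity
  have b2 : 0 ≤ G ^ 2 * ((K₂ * K₁) ^ 2 + 1) := by positivity
  linarith

/-! ### Moments of vector-valued functions -/

/-- The moment `∫₀¹ τ^j g(τ) dτ`. -/
noncomputable def moment {X : Type*} [NormedAddCommGroup X] [NormedSpace ℝ X] (j : ℕ)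
    (g : ℝ → X) : X :=
  ∫ τ in (0 : ℝ)..1, τ ^ j • g τ

section moments

variable {X Y : Type*} [NormedAddCommGroup X] [NormedSpace ℝ X]
  [NormedAddCommGroup Y] [NormedSpace ℝ Y]

theorem intervalIntegrable_pow_smul {g : ℝ → X} (hg : ContinuousOn g (Icc 0 1)) (j : ℕ) :
    IntervalIntegrable (fun τ => τ ^ j • g τ) volume 0 1 :=
  ContinuousOn.intervalIntegrable_of_Icc zero_le_one (by fun_prop)

theorem moment_sub {g h : ℝ → X} (hg : ContinuousOn g (Icc 0 1)) (hh : ContinuousOn h (Icc 0 1))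
    (j : ℕ) : moment j (fun τ => g τ - h τ) = moment j g - moment j h := by
  simp only [moment, smul_sub]
  exact intervalIntegral.integral_sub (intervalIntegrable_pow_smul hg j)
    (intervalIntegrable_pow_smul hh j)

theorem map_moment [CompleteSpace X] [CompleteSpace Y] {g : ℝ → X}
    (hg : ContinuousOn g (Icc 0 1)) (j : ℕ) (T : X →L[ℝ] Y) :
    T (moment j g) = moment j fun τ => T (g τ) := by
  rw [moment, ← T.intervalIntegral_comp_comm (intervalIntegrable_pow_smul hg j)]
  simp [moment]

theorem moment_sum_pow [CompleteSpace X] (n j : ℕ) (c : ℕ → X) :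
    moment j (fun τ => ∑ i ∈ Finset.range n, τ ^ i • c i)
      = ∑ i ∈ Finset.range n, (1 / ((i : ℝ) + j + 1)) • c i := by
  simp only [moment, Finset.smul_sum, smul_smul, ← pow_add]
  rw [intervalIntegral.integral_finsetSum fun i _ =>
    Continuous.intervalIntegrable (by fun_prop) _ _]
  refine Finset.sum_congr rfl fun i _ => ?_
  rw [intervalIntegral.integral_smul_const, integral_pow_zero_one]
  push_cast
  rw [add_comm (j : ℝ)]

theorem norm_moment_le {g : ℝ → X} {B : ℝ} (hB : ∀ τ ∈ Icc (0 : ℝ) 1, ‖g τ‖ ≤ B) (j : ℕ) :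
    ‖moment j g‖ ≤ B := by
  refine (intervalIntegral.norm_integral_le_of_norm_le_const (C := B) fun τ hτ => ?_).trans_eq
    (by simp)
  rw [uIoc_of_le zero_le_one] at hτ
  have h := hB τ (Ioc_subset_Icc_self hτ)
  rw [norm_smul, norm_pow, Real.norm_eq_abs, abs_of_pos hτ.1]
  exact (mul_le_of_le_one_left (norm_nonneg _) (pow_le_one₀ hτ.1.le hτ.2)).trans h

end moments

/-! ### Taylor approximation and the moment-preserving projection -/

theorem norm_le_integral_norm_deriv {Y : Type*} [NormedAddCommGroup Y] [NormedSpace ℝ Y]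
    [CompleteSpace Y] {g g' : ℝ → Y} (hg : ContinuousOn g (Icc 0 1))
    (hd : ∀ τ ∈ Ioo (0 : ℝ) 1, HasDerivAt g (g' τ) τ) (hg' : ContinuousOn g' (Icc 0 1))
    (h1 : g 1 = 0) {s : ℝ} (hs : s ∈ Icc (0 : ℝ) 1) :
    ‖g s‖ ≤ ∫ τ in (0 : ℝ)..1, ‖g' τ‖ := by
  have hi : IntervalIntegrable g' volume 0 1 := hg'.intervalIntegrable_of_Icc zero_le_one
  have hsub : uIcc s 1 ⊆ uIcc 0 1 := by
    rw [uIcc_of_le hs.2, uIcc_of_le zero_le_one]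
    exact Icc_subset_Icc_left hs.1
  have h := intervalIntegral.integral_eq_sub_of_hasDerivAt_of_le hs.2
    (hg.mono (Icc_subset_Icc_left hs.1)) (fun τ hτ => hd τ ⟨hs.1.trans_lt hτ.1, hτ.2⟩)
    (hi.mono_set hsub)
  rw [h1, zero_sub] at h
  rw [← norm_neg, ← h]
  refine (intervalIntegral.norm_integral_le_integral_norm hs.2).trans ?_
  exact intervalIntegral.integral_mono_interval hs.1 hs.2 le_rfl
    (Filter.Eventually.of_forall fun _ => norm_nonneg _) hi.norm

/-- Taylor approximation at `1`, with the remainder bounded in every semi-norm `‖T ·‖` by the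
integral of that semi-norm of the last derivative. -/
theorem exists_taylor.{u, v} {X : Type u} [NormedAddCommGroup X] [NormedSpace ℝ X] (m : ℕ) :
    ∀ w : ℝ → X, ContDiffOn ℝ ((m + 1 : ℕ) : WithTop ℕ∞) w (Icc 0 1) →
    ∃ c : ℕ → X, ∑ j ∈ Finset.range (m + 1), c j = w 1 ∧
      ∀ {Y : Type v} [NormedAddCommGroup Y] [NormedSpace ℝ Y] [CompleteSpace Y] (T : X →L[ℝ] Y),
        ∀ s ∈ Icc (0 : ℝ) 1, ‖T (w s - ∑ j ∈ Finset.range (m + 1), s ^ j • c j)‖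
          ≤ ∫ τ in (0 : ℝ)..1, ‖T (iteratedDerivWithin (m + 1) w (Icc 0 1) τ)‖ := by
  have hud : UniqueDiffOn ℝ (Icc (0 : ℝ) 1) := uniqueDiffOn_Icc_zero_one
  have hder : ∀ w : ℝ → X, ContDiffOn ℝ 1 w (Icc 0 1) → ∀ τ ∈ Ioo (0 : ℝ) 1,
      HasDerivAt w (derivWithin w (Icc 0 1) τ) τ := fun w hw τ hτ =>
    ((hw.differentiableOn one_ne_zero) τ (Ioo_subset_Icc_self hτ)).hasDerivWithinAt.hasDerivAt
      (Icc_mem_nhds hτ.1 hτ.2)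
  induction m with
  | zero =>
    intro w hw
    have hw1 : ContDiffOn ℝ 1 w (Icc 0 1) := hw
    refine ⟨fun _ => w 1, by simp, fun {Y} _ _ _ T s hs => ?_⟩
    have h := norm_le_integral_norm_deriv (g := fun τ => T (w τ - w 1))
      (g' := fun τ => T (derivWithin w (Icc 0 1) τ))
      (T.continuous.comp_continuousOn (hw.continuousOn.sub continuousOn_const))
      (fun τ hτ => T.hasFDerivAt.comp_hasDerivAt τ ((hder w hw1 τ hτ).sub_const _))
      (T.continuous.comp_continuousOn (hw1.continuousOn_derivWithin hud le_rfl)) (by simp) hs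
    simpa [iteratedDerivWithin_succ'] using h
  | succ m ih =>
    intro w hw
    have hw1 : ContDiffOn ℝ 1 w (Icc 0 1) := hw.of_le (by norm_cast; omega)
    have hw' : ContDiffOn ℝ ((m + 1 : ℕ) : WithTop ℕ∞) (derivWithin w (Icc 0 1)) (Icc 0 1) :=
      hw.derivWithin hud (by norm_cast)
    obtain ⟨c, -, hc⟩ := ih _ hw'
    let b : ℕ → X := fun j => ((j : ℝ) + 1)⁻¹ • c j
    let p : ℝ → X := fun s => ∑ j ∈ Finset.range (m + 1), s ^ (j + 1) • b j
    have hp : ∀ τ, HasDerivAt p (∑ j ∈ Finset.range (m + 1), τ ^ j • c j) τ := by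
      intro τ
      refine HasDerivAt.fun_sum fun j _ => ?_
      have h := (hasDerivAt_pow (j + 1) τ).smul_const (b j)
      convert h using 1
      rw [smul_smul]
      congr 1
      push_cast
      field_simp
    -- Integrate the approximation of the derivative and choose the constant term so that the value
    -- at 1 is matched.
    refine ⟨fun j => Nat.casesOn j (w 1 - p 1) b, ?_, fun {Y} _ _ _ T s hs => ?_⟩
    · rw [Finset.sum_range_succ']
      simp [p]
    · have e : ∀ s : ℝ, w s - ∑ j ∈ Finset.range (m + 1 + 1),
          s ^ j • (Nat.casesOn j (w 1 - p 1) b : X) = w s - (p s + (w 1 - p 1)) := by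
        intro s
        rw [Finset.sum_range_succ']
        simp [p]
      rw [e]
      have hcp : Continuous p := by fun_prop
      have h := norm_le_integral_norm_deriv (g := fun τ => T (w τ - (p τ + (w 1 - p 1))))
        (g' := fun τ => T (derivWithin w (Icc 0 1) τ - ∑ j ∈ Finset.range (m + 1), τ ^ j • c j))
        (T.continuous.comp_continuousOn (hw.continuousOn.sub (by fun_prop)))
        (fun τ hτ => T.hasFDerivAt.comp_hasDerivAt τ
          ((hder w hw1 τ hτ).sub ((hp τ).add_const _)))
        (T.continuous.comp_continuousOn
          ((hw1.continuousOn_derivWithin hud le_rfl).sub (by fun_prop))) (by simp) hs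
      refine h.trans ?_
      rw [iteratedDerivWithin_succ']
      -- The bound for the derivative's remainder is uniform on an interval of length 1, so
      -- integration reproduces it without a new factor.
      refine (le_abs_self _).trans ((intervalIntegral.norm_integral_le_of_norm_le_const
        (f := fun τ => ‖T (derivWithin w (Icc 0 1) τ - ∑ j ∈ Finset.range (m + 1), τ ^ j • c j)‖)
        fun τ hτ => ?_).trans_eq (by rw [sub_zero, abs_one, mul_one]))
      rw [uIoc_of_le zero_le_one] at hτ
      rw [norm_norm]
      exact hc T τ (Ioc_subset_Icc_self hτ)

open Polynomial in
/-- Polynomials of degree at most `q` that vanish at `1` and are dual to the moments of order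
less than `q`. -/
theorem exists_dual_moments (q : ℕ) : ∃ b : ℕ → ℕ → ℝ, ∀ l,
    ∑ j ∈ Finset.range (q + 1), b l j = 0 ∧
    ∀ k < q, ∑ j ∈ Finset.range (q + 1), b l j / ((j : ℝ) + k + 1) = if k = l then 1 else 0 := by
  suffices key : ∀ l : ℕ, ∃ b : ℕ → ℝ, ∑ j ∈ Finset.range (q + 1), b j = 0 ∧
      ∀ k < q, ∑ j ∈ Finset.range (q + 1), b j / ((j : ℝ) + k + 1) = if k = l then 1 else 0 by
    choose b hb using key
    exact ⟨b, hb⟩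
  intro l
  -- The weight 1 - τ becomes a factor of the polynomial and forces the zero at 1.
  obtain ⟨p, hp, h⟩ := exists_moments_eq (w := fun τ => 1 - τ) (by fun_prop)
    (fun τ hτ => sub_pos.2 hτ.2) q (fun k => if k = l then 1 else 0)
  rcases eq_or_ne p 0 with rfl | hp0
  · exact ⟨0, by simp, fun k hk => by simpa using h k hk⟩
  have hP : ((1 - X) * p).degree < ((q + 1 : ℕ) : WithBot ℕ) := by
    refine (degree_mul_le _ _).trans_lt ?_
    have h1 : (1 - X : ℝ[X]).degree ≤ 1 := (degree_sub_le _ _).trans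
      (max_le (degree_one_le.trans zero_le_one) degree_X_le)
    rw [degree_eq_natDegree hp0]
    have h2 := (natDegree_lt_iff_degree_lt hp0).2 hp
    refine (add_le_add h1 le_rfl).trans_lt ?_
    exact_mod_cast (by omega : 1 + p.natDegree < q + 1)
  refine ⟨((1 - X) * p).coeff, ?_, fun k hk => ?_⟩
  · have h : ((1 - X) * p).eval 1 = 0 := by simp
    rcases eq_or_ne ((1 - X) * p) 0 with h0 | h0
    · simp [h0]
    rw [eval_eq_sum_range' ((natDegree_lt_iff_degree_lt h0).2 hP)] at h
    simpa using h
  · rw [← integral_eval_mul_pow hP]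
    refine Eq.trans ?_ (h k hk)
    simp

/-- The projection onto polynomials of degree at most `q` that interpolates at `1` and preserves
the moments of order less than `q`. -/
theorem exists_projection.{u, v} (q : ℕ) : ∃ C : ℝ, 0 < C ∧
    ∀ {X : Type u} [NormedAddCommGroup X] [NormedSpace ℝ X] [CompleteSpace X] (w : ℝ → X),
      ContDiffOn ℝ ((q + 1 : ℕ) : WithTop ℕ∞) w (Icc 0 1) →
    ∃ c : ℕ → X, ∑ i ∈ Finset.range (q + 1), c i = w 1 ∧
      (∀ k < q, ∑ i ∈ Finset.range (q + 1), (1 / ((i : ℝ) + k + 1)) • c i = moment k w) ∧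
      ∀ {Y : Type v} [NormedAddCommGroup Y] [NormedSpace ℝ Y] [CompleteSpace Y] (T : X →L[ℝ] Y),
        ‖T (moment q w - ∑ i ∈ Finset.range (q + 1), (1 / ((i : ℝ) + q + 1)) • c i)‖
          ≤ C * ∫ τ in (0 : ℝ)..1, ‖T (iteratedDerivWithin (q + 1) w (Icc 0 1) τ)‖ := by
  obtain ⟨b, hb⟩ := exists_dual_moments q
  -- γ l is the q-th moment of the l-th dual polynomial, the one moment that duality does not
  -- prescribe.
  let γ : ℕ → ℝ := fun l => ∑ j ∈ Finset.range (q + 1), b l j / ((j : ℝ) + q + 1)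
  refine ⟨1 + ∑ l ∈ Finset.range q, |γ l|, by positivity, fun {X} _ _ _ w hw => ?_⟩
  obtain ⟨a, ha1, ha⟩ := exists_taylor.{u, v} q w hw
  set p : ℝ → X := fun s => ∑ j ∈ Finset.range (q + 1), s ^ j • a j with hp
  set R : ℝ → X := fun s => w s - p s with hR
  have hpc : ContinuousOn p (Icc 0 1) := by fun_prop
  have hRc : ContinuousOn R (Icc 0 1) := hw.continuousOn.sub hpc
  have hRm : ∀ k, moment k R = moment k w
      - ∑ i ∈ Finset.range (q + 1), (1 / ((i : ℝ) + k + 1)) • a i := fun k => by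
    rw [hR, moment_sub hw.continuousOn hpc, hp, moment_sum_pow]
  have hsum : ∀ k : ℕ, ∑ i ∈ Finset.range (q + 1), (1 / ((i : ℝ) + k + 1)) •
        (a i + ∑ l ∈ Finset.range q, b l i • moment l R)
      = ∑ i ∈ Finset.range (q + 1), (1 / ((i : ℝ) + k + 1)) • a i
        + ∑ l ∈ Finset.range q,
          (∑ j ∈ Finset.range (q + 1), b l j / ((j : ℝ) + k + 1)) • moment l R := by
    intro k
    simp_rw [smul_add, Finset.sum_add_distrib, Finset.smul_sum, smul_smul, Finset.sum_smul]
    congr 1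
    rw [Finset.sum_comm]
    simp_rw [one_div_mul_eq_div]
  -- The Taylor polynomial is corrected by dual polynomials carrying the moments of the remainder R;
  -- as they vanish at 1, the value there is kept.
  refine ⟨fun i => a i + ∑ l ∈ Finset.range q, b l i • moment l R, ?_, fun k hk => ?_,
    fun {Y} _ _ _ T => ?_⟩
  · rw [Finset.sum_add_distrib, ha1, Finset.sum_comm]
    simp_rw [← Finset.sum_smul, (hb _).1]
    simp
  · rw [hsum, Finset.sum_eq_single_of_mem (s := Finset.range q) k (Finset.mem_range.2 hk)
      fun l _ hl => by rw [(hb l).2 k hk, if_neg hl.symm, zero_smul],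
      (hb k).2 k hk, if_pos rfl, one_smul, hRm, add_sub_cancel]
  · rw [hsum, ← sub_sub, ← hRm, map_sub, map_sum]
    set I := ∫ τ in (0 : ℝ)..1, ‖T (iteratedDerivWithin (q + 1) w (Icc 0 1) τ)‖ with hI
    have hm : ∀ k, ‖T (moment k R)‖ ≤ I := fun k => by
      rw [map_moment hRc]
      exact norm_moment_le (ha T) k
    refine (norm_sub_le _ _).trans ?_
    rw [add_mul, one_mul, Finset.sum_mul]
    refine add_le_add (hm q) ((norm_sum_le _ _).trans (Finset.sum_le_sum fun l _ => ?_))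
    rw [map_smul, norm_smul, Real.norm_eq_abs]
    exact mul_le_mul_of_nonneg_left (hm l) (abs_nonneg _)

/-! ### Density of dom(A), Poincaré's inequality and the inverse of the Dirichlet Laplacian -/

section sobolev

noncomputable local instance {d : ℕ} {Ω : Set (EuclideanSpace ℝ (Fin d))} :
    NormedAddCommGroup (H01 Ω) := Submodule.normedAddCommGroup _

noncomputable local instance {d : ℕ} {Ω : Set (EuclideanSpace ℝ (Fin d))} :
    NormedSpace ℝ (H01 Ω) := Submodule.normedSpace _

noncomputable local instance {d : ℕ} {Ω : Set (EuclideanSpace ℝ (Fin d))} :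
    NormedAddCommGroup (DomA Ω) := Submodule.normedAddCommGroup _

noncomputable local instance {d : ℕ} {Ω : Set (EuclideanSpace ℝ (Fin d))} :
    NormedSpace ℝ (DomA Ω) := Submodule.normedSpace _

section spaces

variable {d : ℕ} {Ω : Set (EuclideanSpace ℝ (Fin d))}

instance : CompleteSpace (H01 Ω) := by
  unfold H01 H01Submodule
  infer_instance

/-- `H01.toL2` as a continuous linear map. -/
noncomputable def H01.toL2L : H01 Ω →L[ℝ] L2 Ω where
  toFun v := v.toL2
  map_add' _ _ := rfl
  map_smul' _ _ := rfl
  cont := (WithLp.continuous_fst _ _ _).comp continuous_subtype_val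

/-- `H01.grad` as a continuous linear map. -/
noncomputable def H01.gradL : H01 Ω →L[ℝ] L2Vec Ω where
  toFun v := v.grad
  map_add' _ _ := rfl
  map_smul' _ _ := rfl
  cont := (WithLp.continuous_snd _ _ _).comp continuous_subtype_val

/-- `DomA.toH01` as a continuous linear map. -/
noncomputable def DomA.toH01L : DomA Ω →L[ℝ] H01 Ω where
  toFun v := v.toH01
  map_add' _ _ := rfl
  map_smul' _ _ := rfl
  cont := (WithLp.continuous_fst _ _ _).comp continuous_subtype_val

/-- `DomA.lap` as a continuous linear map. -/
noncomputable def DomA.lapL : DomA Ω →L[ℝ] L2 Ω where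
  toFun v := v.lap
  map_add' _ _ := rfl
  map_smul' _ _ := rfl
  cont := (WithLp.continuous_snd _ _ _).comp continuous_subtype_val


theorem energy_comm (v w : H01 Ω) : energy v w = energy w v := real_inner_comm _ _

theorem DomA.energy_eq (v : DomA Ω) (w : H01 Ω) : energy v.toH01 w = ⟪v.lap, w.toL2⟫_ℝ := v.2 w

instance : CompleteSpace (DomA Ω) := by
  have hcl : IsClosed (dirichletGraph Ω : Set (WithLp 2 (H01 Ω × L2 Ω))) := by
    have e : (dirichletGraph Ω : Set (WithLp 2 (H01 Ω × L2 Ω)))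
        = ⋂ w : H01 Ω, {p | ⟪H01.gradL p.fst, w.grad⟫_ℝ = ⟪p.snd, w.toL2⟫_ℝ} := by
      ext p
      simp only [mem_iInter]
      rfl
    rw [e]
    exact isClosed_iInter fun w => isClosed_eq
      ((H01.gradL.continuous.comp (WithLp.continuous_fst _ _ _)).inner continuous_const)
      ((WithLp.continuous_snd _ _ _).inner continuous_const)
  exact hcl.completeSpace_coe

/-- `dom(A)` is dense in `H₀¹(Ω)`. -/
theorem DomA.denseRange_toH01 (hΩ : IsOpen Ω) : DenseRange (DomA.toH01 : DomA Ω → H01 Ω) := by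
  have h : (LinearMap.range (DomA.toH01L : DomA Ω →L[ℝ] H01 Ω).toLinearMap).topologicalClosure
      = ⊤ := by
    rw [Submodule.topologicalClosure_eq_top_iff, Submodule.eq_bot_iff]
    intro w hw
    refine H01.eq_of_toL2_eq hΩ (ext_inner_left ℝ fun g => ?_)
    -- v represents z ↦ (g, z) in the H¹ inner product, so it solves v - Δv = g weakly and lies in
    -- dom(A) with A v = g - v. Orthogonality of w to v then reads (g, w) = 0.
    let v : H01 Ω := (H01.toL2L : H01 Ω →L[ℝ] L2 Ω).adjoint g
    have hv : ∀ z : H01 Ω, ⟪v, z⟫_ℝ = ⟪g, z.toL2⟫_ℝ := fun z =>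
      ContinuousLinearMap.adjoint_inner_left _ _ _
    have hI : ∀ z : H01 Ω, ⟪v, z⟫_ℝ = ⟪v.toL2, z.toL2⟫_ℝ + energy v z := fun z => rfl
    have hmem : WithLp.toLp 2 (v, g - v.toL2) ∈ dirichletGraph Ω := by
      intro z
      change energy v z = ⟪g - v.toL2, z.toL2⟫_ℝ
      rw [inner_sub_left, ← hv, hI]
      ring
    have h0 := (Submodule.mem_orthogonal _ _).1 hw v ⟨⟨_, hmem⟩, rfl⟩
    rw [← hv, h0]
    exact inner_zero_right _ |>.symm
  intro x
  have hx : x ∈ (LinearMap.range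
      (DomA.toH01L : DomA Ω →L[ℝ] H01 Ω).toLinearMap).topologicalClosure := by
    rw [h]
    trivial
  exact hx

/-- Poincaré's inequality is not linear in p and cannot be checked on generators of a span; the test
functions already form a subspace. -/
theorem mem_testGraph_of_mem_span {p : WithLp 2 (L2 Ω × L2Vec Ω)}
    (hp : p ∈ Submodule.span ℝ (testGraph Ω)) : p ∈ testGraph Ω := by
  induction hp using Submodule.span_induction with
  | mem p hp => exact hp
  | zero =>
    refine ⟨0, contDiff_const, HasCompactSupport.zero, by simp [tsupport], ?_, ?_⟩
    · exact Lp.coeFn_zero ..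
    · refine (Lp.coeFn_zero ..).trans (Filter.Eventually.of_forall fun x => ?_)
      simp [gradient]
  | add p r _ _ hp hr =>
    obtain ⟨φ, h1, h2, h3, h4, h5⟩ := hp
    obtain ⟨ψ, g1, g2, g3, g4, g5⟩ := hr
    refine ⟨φ + ψ, h1.add g1, h2.add g2, (tsupport_add φ ψ).trans (union_subset h3 g3), ?_, ?_⟩
    · filter_upwards [h4, g4, Lp.coeFn_add p.fst r.fst] with x a b c
      rw [WithLp.add_fst, c, Pi.add_apply, Pi.add_apply, a, b]
    · filter_upwards [h5, g5, Lp.coeFn_add p.snd r.snd] with x a b c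
      rw [WithLp.add_snd, c, Pi.add_apply, a, b]
      simp only [gradient]
      rw [fderiv_add (h1.differentiable (by simp) x) (g1.differentiable (by simp) x), map_add]
  | smul c p _ hp =>
    obtain ⟨φ, h1, h2, h3, h4, h5⟩ := hp
    refine ⟨c • φ, h1.const_smul c, h2.smul_left (f := fun _ => c),
      (tsupport_smul_subset_right (fun _ => c) φ).trans h3, ?_, ?_⟩
    · filter_upwards [h4, Lp.coeFn_smul c p.fst] with x a b
      rw [WithLp.smul_fst, b, Pi.smul_apply, Pi.smul_apply, a]
    · filter_upwards [h5, Lp.coeFn_smul c p.snd] with x a b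
      rw [WithLp.smul_snd, b, Pi.smul_apply, a]
      simp only [gradient]
      rw [fderiv_const_smul (h1.differentiable (by simp) x), map_smul]

/-- The Poincaré inequality for test functions. -/
theorem norm_fst_le_of_mem_testGraph (hd : 0 < d) (hΩ : IsOpen Ω) {R : ℝ}
    (hR : ∀ x ∈ Ω, ‖x‖ ≤ R) (hR0 : 0 ≤ R) {p : WithLp 2 (L2 Ω × L2Vec Ω)} (hp : p ∈ testGraph Ω) :
    ‖p.fst‖ ≤ 2 * R * ‖p.snd‖ := by
  obtain ⟨φ, h1, h2, h3, h4, h5⟩ := hp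
  let y : EuclideanSpace ℝ (Fin d) := EuclideanSpace.single ⟨0, hd⟩ 1
  have hy : ‖y‖ = 1 := by simp [y]
  have hφ1 : ContDiff ℝ 1 φ := h1.of_le (by exact_mod_cast le_top)
  have hφ' : Continuous fun x => fderiv ℝ φ x y :=
    (hφ1.continuous_fderiv one_ne_zero).clm_apply continuous_const
  have hφc := h1.continuous
  have hint : Integrable fun x => fderiv ℝ (fun x => φ x * φ x) x y * innerSL ℝ y x := by
    have hc : Continuous fun x => fderiv ℝ (fun x => φ x * φ x) x y :=
      ((hφ1.mul hφ1).continuous_fderiv one_ne_zero).clm_apply continuous_const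
    exact Continuous.integrable_of_hasCompactSupport (by fun_prop)
      ((HasCompactSupport.mul_right (f := φ) (f' := φ) h2).fderiv_apply (𝕜 := ℝ) y).mul_right
  -- As ∂_y (y·x) = 1, integration by parts gives ∫φ² = -2 ∫ φ (∂_y φ) (y·x).
  have hparts := integral_mul_fderiv_eq_neg_fderiv_mul_of_integrable (𝕜 := ℝ) (μ := volume)
    (f := fun x => φ x * φ x) (g := fun x => innerSL ℝ y x) (v := y) ?_ ?_ ?_ ?_ ?_
  · have hder : ∀ x, fderiv ℝ (fun x => φ x * φ x) x y = 2 * φ x * fderiv ℝ φ x y := by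
      intro x
      have hx := hφ1.differentiable one_ne_zero x
      rw [fderiv_fun_mul hx hx]
      simp
      ring
    simp only [ContinuousLinearMap.fderiv, hder] at hparts hint
    have hyy : (innerSL ℝ y) y = 1 := by simp [hy]
    simp only [hyy, mul_one] at hparts
    have hsqi : Integrable (fun x => φ x * φ x) :=
      (hφc.mul hφc).integrable_of_hasCompactSupport h2.mul_right
    have hg : ∀ x, |fderiv ℝ φ x y| ≤ ‖gradient φ x‖ := by
      intro x
      rw [← InnerProductSpace.toDual_symm_apply (𝕜 := ℝ)]
      refine (abs_real_inner_le_norm _ _).trans ?_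
      rw [hy, mul_one]
      rfl
    have hgc : Continuous fun x => ‖gradient φ x‖ ^ 2 :=
      (((InnerProductSpace.toDual ℝ _).symm.continuous.comp
        (hφ1.continuous_fderiv one_ne_zero)).norm.pow 2)
    have hgs : HasCompactSupport fun x => ‖gradient φ x‖ ^ 2 := by
      refine (h2.fderiv (𝕜 := ℝ)).comp_left (g := fun L => ‖(InnerProductSpace.toDual ℝ
        (EuclideanSpace ℝ (Fin d))).symm L‖ ^ 2) ?_
      simp
    have hgi : Integrable (fun x => ‖gradient φ x‖ ^ 2) :=
      hgc.integrable_of_hasCompactSupport hgs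
    have e1 : ‖p.fst‖ ^ 2 = ∫ x in Ω, φ x * φ x := by
      rw [← real_inner_self_eq_norm_sq, L2.inner_def]
      refine integral_congr_ae ?_
      filter_upwards [h4] with x hx
      rw [hx]
      simp [sq]
    have e2 : ‖p.snd‖ ^ 2 = ∫ x in Ω, ‖gradient φ x‖ ^ 2 := by
      rw [← real_inner_self_eq_norm_sq, L2.inner_def]
      refine integral_congr_ae ?_
      filter_upwards [h5] with x hx
      rw [hx, real_inner_self_eq_norm_sq]
    have hzero : ∀ x ∉ Ω, φ x = 0 := fun x hx =>
      image_eq_zero_of_notMem_tsupport fun h => hx (h3 h)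
    have s1 := setIntegral_eq_integral_of_forall_compl_eq_zero (μ := volume) (s := Ω)
      (f := fun x => φ x * φ x) fun x hx => by rw [hzero x hx, zero_mul]
    have s2 := setIntegral_eq_integral_of_forall_compl_eq_zero (μ := volume) (s := Ω)
      (f := fun x => 2 * φ x * fderiv ℝ φ x y * innerSL ℝ y x)
      fun x hx => by rw [hzero x hx]; ring
    rw [← s1, ← s2, ← integral_neg] at hparts
    have hle : ∫ x in Ω, φ x * φ x
        ≤ ∫ x in Ω, (φ x * φ x / 2 + 2 * R ^ 2 * ‖gradient φ x‖ ^ 2) := by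
      rw [hparts]
      refine setIntegral_mono_on₀ hint.neg.integrableOn
        ((hsqi.div_const 2).add (hgi.const_mul _)).integrableOn hΩ.nullMeasurableSet ?_
      intro x hx
      have a1 : |fderiv ℝ φ x y * innerSL ℝ y x| ≤ R * ‖gradient φ x‖ := by
        rw [abs_mul, mul_comm]
        refine mul_le_mul ?_ (hg x) (abs_nonneg _) hR0
        refine (abs_real_inner_le_norm y x).trans ?_
        rw [hy, one_mul]
        exact hR x hx
      have a2 : (fderiv ℝ φ x y * innerSL ℝ y x) ^ 2 ≤ (R * ‖gradient φ x‖) ^ 2 := by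
        rw [← sq_abs]
        exact pow_le_pow_left₀ (abs_nonneg _) a1 2
      -- Young's inequality with weights that let half of ∫φ² be absorbed on the left.
      have a3 := sq_nonneg (φ x + 2 * (fderiv ℝ φ x y * innerSL ℝ y x))
      linarith
    rw [integral_add (hsqi.div_const 2).integrableOn (hgi.const_mul _).integrableOn,
      integral_div, integral_const_mul, ← e1, ← e2] at hle
    refine (sq_le_sq₀ (norm_nonneg _) (by positivity)).1 ?_
    rw [mul_pow]
    linarith
  · exact hint
  · exact Continuous.integrable_of_hasCompactSupport
      (by simp only [ContinuousLinearMap.fderiv]; fun_prop) h2.mul_right.mul_right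
  · exact Continuous.integrable_of_hasCompactSupport (by fun_prop) h2.mul_right.mul_right
  · exact fun x _ => ((hφ1.mul hφ1).differentiable one_ne_zero) x
  · exact fun x _ => (innerSL ℝ y).differentiableAt

/-- The **Poincaré inequality** on `H₀¹(Ω)`. -/
theorem exists_poincare (hd : 0 < d) (hΩ : IsOpen Ω) (hb : Bornology.IsBounded Ω) :
    ∃ R : ℝ, 0 ≤ R ∧ ∀ v : H01 Ω, ‖v.toL2‖ ≤ R * ‖v.grad‖ := by
  obtain ⟨R, hR0, hR⟩ := hb.exists_pos_norm_le
  refine ⟨2 * R, by positivity, fun v => ?_⟩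
  have hcl : IsClosed {p : WithLp 2 (L2 Ω × L2Vec Ω) | ‖p.fst‖ ≤ 2 * R * ‖p.snd‖} :=
    isClosed_le (WithLp.continuous_fst _ _ _).norm
      (continuous_const.mul (WithLp.continuous_snd _ _ _).norm)
  exact closure_minimal (fun p hp => norm_fst_le_of_mem_testGraph hd hΩ hR hR0.le
    (mem_testGraph_of_mem_span hp)) hcl v.2

/-- The solution operator of the Dirichlet problem. -/
theorem exists_solutionOperator (hd : 0 < d) (hΩ : IsOpen Ω) (hb : Bornology.IsBounded Ω) :
    ∃ S : L2 Ω →ₗ[ℝ] H01 Ω, ∀ g w, energy (S g) w = ⟪g, w.toL2⟫_ℝ := by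
  obtain ⟨R, hR0, hR⟩ := exists_poincare hd hΩ hb
  let B : H01 Ω →L[ℝ] H01 Ω →L[ℝ] ℝ :=
    (innerSL ℝ : L2Vec Ω →L[ℝ] L2Vec Ω →L[ℝ] ℝ).bilinearComp H01.gradL H01.gradL
  have hB : IsCoercive B := by
    refine ⟨(R ^ 2 + 1)⁻¹, by positivity, fun u => ?_⟩
    have e1 : B u u = ‖u.grad‖ ^ 2 := real_inner_self_eq_norm_sq u.grad
    have e2 : ‖u‖ * ‖u‖ = ‖u.toL2‖ ^ 2 + ‖u.grad‖ ^ 2 := by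
      rw [← sq]
      exact WithLp.prod_norm_sq_eq_of_L2 _
    rw [e1, mul_assoc, e2, inv_mul_le_iff₀ (by positivity)]
    have := pow_le_pow_left₀ (norm_nonneg _) (hR u) 2
    rw [mul_pow] at this
    linarith
  refine ⟨(hB.continuousLinearEquivOfBilin.symm : H01 Ω →L[ℝ] H01 Ω).toLinearMap.comp
    (ContinuousLinearMap.adjoint (H01.toL2L : H01 Ω →L[ℝ] L2 Ω)).toLinearMap, fun g w => ?_⟩
  have h := hB.continuousLinearEquivOfBilin_apply (hB.continuousLinearEquivOfBilin.symm
    (ContinuousLinearMap.adjoint (H01.toL2L : H01 Ω →L[ℝ] L2 Ω) g)) w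
  rw [ContinuousLinearEquiv.apply_symm_apply, ContinuousLinearMap.adjoint_inner_left] at h
  exact h.symm

end spaces

/-! ### Test functions supported on one mesh interval -/

section localization

/-- The function that is `((s - t_n) / k_n)^j v` on the mesh interval `(t_n, t_{n+1}]` and zero
elsewhere. -/
noncomputable def bump {X : Type*} [NormedAddCommGroup X] [NormedSpace ℝ X] (t : ℕ → ℝ)
    (n j : ℕ) (v : X) : ℝ → X :=
  indicator (Ioc (t n) (t (n + 1))) fun s => ((s - t n) / (t (n + 1) - t n)) ^ j • v

variable {X : Type*} [NormedAddCommGroup X] [NormedSpace ℝ X] {N : ℕ} {t : ℕ → ℝ}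

theorem mesh_le (ht : ∀ n < N, t n < t (n + 1)) {i j : ℕ} (hij : i ≤ j) (hj : j ≤ N) :
    t i ≤ t j := by
  induction j, hij using Nat.le_induction with
  | base => exact le_rfl
  | succ j _ ih => exact (ih (by omega)).trans (ht j (by omega)).le

theorem bump_eq_zero_of_ne (ht : ∀ n < N, t n < t (n + 1)) {m n : ℕ} (hm : m < N) (hn : n < N)
    (hmn : m ≠ n) (j : ℕ) (v : X) {s : ℝ} (hs : s ∈ Ioc (t m) (t (m + 1))) :
    bump t n j v s = 0 := by
  refine indicator_of_notMem (fun h => ?_) _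
  rcases lt_or_gt_of_ne hmn with h1 | h1
  · exact absurd (hs.2.trans (mesh_le ht h1 hn.le)) (not_le.2 h.1)
  · exact absurd (h.2.trans (mesh_le ht h1 hm.le)) (not_le.2 hs.1)

theorem map_bump {X' : Type*} [NormedAddCommGroup X'] [NormedSpace ℝ X'] (T : X →L[ℝ] X')
    (n j : ℕ) (v : X) (s : ℝ) : T (bump t n j v s) = bump t n j (T v) s := by
  by_cases h : s ∈ Ioc (t n) (t (n + 1)) <;> simp [bump, h]

open Polynomial in
theorem piecewisePoly_bump (ht : ∀ n < N, t n < t (n + 1)) {n : ℕ} (hn : n < N) {j q : ℕ}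
    (hj : j ≤ q) (v : X) : PiecewisePoly q N t (bump t n j v) := by
  intro m hm
  rcases eq_or_ne m n with rfl | hmn
  · let p : ℝ[X] := (C (t (m + 1) - t m)⁻¹ * (Polynomial.X - C (t m))) ^ j
    have hp : p.natDegree < q + 1 := by
      refine (natDegree_pow_le_of_le j (natDegree_C_mul_le _ _)).trans_lt ?_
      rw [natDegree_X_sub_C]
      omega
    refine ⟨fun i => p.coeff i • v, fun s hs => ?_⟩
    have h := eval_eq_sum_range' hp s
    simp only [smul_smul, ← Finset.sum_smul]
    rw [bump, indicator_of_mem hs]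
    congr 1
    simp_rw [mul_comm (s ^ _), ← h, p]
    simp [div_eq_inv_mul]
  · exact ⟨0, fun s hs => by simp [bump_eq_zero_of_ne ht hm hn hmn j v hs]⟩

theorem piecewiseContDiff_bump (ht : ∀ n < N, t n < t (n + 1)) {n : ℕ} (hn : n < N) (j : ℕ)
    (v : X) : PiecewiseContDiff ∞ N t (bump t n j v) := by
  intro m hm
  rcases eq_or_ne m n with rfl | hmn
  · exact ⟨fun s => ((s - t m) / (t (m + 1) - t m)) ^ j • v,
      ContDiff.contDiffOn (by fun_prop), fun s hs => by rw [bump, indicator_of_mem hs]⟩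
  · exact ⟨0, contDiffOn_const, fun s hs => by simp [bump_eq_zero_of_ne ht hm hn hmn j v hs]⟩

theorem rightLim_eq_of_eqOn {Z : Type*} [TopologicalSpace Z] [T2Space Z] {f g : ℝ → Z} {a b : ℝ}
    (hab : a < b) (hfg : EqOn f g (Ioo a b)) (hg : ContinuousWithinAt g (Icc a b) a) :
    Function.rightLim f a = g a := by
  refine rightLim_eq_of_tendsto ?_
  have h1 : Filter.Tendsto g (nhdsWithin a (Ioi a)) (nhds (g a)) := by
    have h2 := hg.mono_left (nhdsWithin_mono a Ioo_subset_Icc_self)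
    rwa [nhdsWithin_Ioo_eq_nhdsGT hab] at h2
  refine h1.congr' ?_
  filter_upwards [Ioo_mem_nhdsGT hab] with s hs using (hfg hs).symm

theorem rightLim_bump (ht : ∀ n < N, t n < t (n + 1)) {m n : ℕ} (hm : m < N) (hn : n < N)
    (j : ℕ) (v : X) :
    Function.rightLim (bump t n j v) (t m) = if m = n ∧ j = 0 then v else 0 := by
  rcases eq_or_ne m n with rfl | hmn
  · rw [rightLim_eq_of_eqOn (ht m hm) (g := fun s => ((s - t m) / (t (m + 1) - t m)) ^ j • v)
      (fun s hs => by rw [bump, indicator_of_mem (Ioo_subset_Ioc_self hs)])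
      (Continuous.continuousWithinAt (by fun_prop))]
    rcases j with _ | j <;> simp
  · rw [rightLim_eq_of_eqOn (ht m hm) (g := 0)
      (fun s hs => bump_eq_zero_of_ne ht hm hn hmn j v (Ioo_subset_Ioc_self hs))
      continuousWithinAt_const]
    simp [hmn]

/-- Integration by parts against `τ^j`. -/
theorem moment_derivWithin [CompleteSpace X] {w : ℝ → X} (hw : ContDiffOn ℝ 1 w (Icc 0 1))
    (j : ℕ) : moment j (derivWithin w (Icc 0 1))
      = w 1 - (if j = 0 then w 0 else 0) - (j : ℝ) • moment (j - 1) w := by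
  have hc : ContinuousOn (derivWithin w (Icc 0 1)) (Icc 0 1) :=
    hw.continuousOn_derivWithin uniqueDiffOn_Icc_zero_one le_rfl
  have h := intervalIntegral.integral_eq_sub_of_hasDerivAt_of_le zero_le_one
    (f := fun τ => τ ^ j • w τ)
    (f' := fun τ => τ ^ j • derivWithin w (Icc 0 1) τ + (j : ℝ) • (τ ^ (j - 1) • w τ))
    (by have := hw.continuousOn; fun_prop)
    (fun τ hτ => by
      have h1 := (((hw.differentiableOn one_ne_zero) τ
        (Ioo_subset_Icc_self hτ)).hasDerivWithinAt.hasDerivAt (Icc_mem_nhds hτ.1 hτ.2))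
      have h2 := (hasDerivAt_pow j τ).smul h1
      rwa [mul_smul] at h2)
    (((intervalIntegrable_pow_smul hc j)).add
      ((intervalIntegrable_pow_smul hw.continuousOn (j - 1)).smul (j : ℝ)))
  have h' := intervalIntegral.integral_add (intervalIntegrable_pow_smul hc j)
    ((intervalIntegrable_pow_smul hw.continuousOn (j - 1)).smul (j : ℝ))
  simp only [Pi.smul_apply, intervalIntegral.integral_smul] at h'
  rw [moment, moment, eq_sub_iff_add_eq, ← h', h]
  rcases j with _ | j <;> simp

/-- A function that agrees with `w` after scaling has the scaled derivative of `w`. -/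
theorem smul_deriv_eq_derivWithin {E : Type*} [NormedAddCommGroup E] [NormedSpace ℝ E] {a b : ℝ}
    {u w : ℝ → E} (hw : ContDiffOn ℝ 1 w (Icc 0 1))
    (huw : ∀ τ ∈ Ioc (0 : ℝ) 1, u (a + (b - a) * τ) = w τ) {τ : ℝ} (hτ : τ ∈ Ioo (0 : ℝ) 1) :
    (b - a) • deriv u (a + (b - a) * τ) = derivWithin w (Icc 0 1) τ := by
  have h1 := (((hw.differentiableOn one_ne_zero) τ
    (Ioo_subset_Icc_self hτ)).hasDerivWithinAt.hasDerivAt (Icc_mem_nhds hτ.1 hτ.2))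
  rw [← h1.deriv]
  have h2 : (fun τ => u (a + (b - a) * τ)) =ᶠ[nhds τ] w := by
    filter_upwards [Ioo_mem_nhds hτ.1 hτ.2] with s hs using huw s (Ioo_subset_Ioc_self hs)
  rw [← h2.deriv_eq, deriv_comp_mul_left (b - a) (fun s => u (a + s)), deriv_comp_const_add]

theorem map_moment_left {E : Type*} [NormedAddCommGroup E] [NormedSpace ℝ E] [CompleteSpace E]
    (B : E →L[ℝ] E →L[ℝ] ℝ) {w : ℝ → E} (hw : ContinuousOn w (Icc 0 1)) (j : ℕ) (v : E) :
    B (moment j w) v = moment j fun τ => B (w τ) v :=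
  map_moment hw j (B.flip v)

theorem continuousOn_form_left {E : Type*} [NormedAddCommGroup E] [NormedSpace ℝ E]
    (B : E →L[ℝ] E →L[ℝ] ℝ) {w : ℝ → E} {s : Set ℝ} (hw : ContinuousOn w s) (v : E) :
    ContinuousOn (fun τ => B (w τ) v) s :=
  (B.flip v).continuous.comp_continuousOn hw

/-- Scaling an integral to `[0, 1]`, where its integrand is a combination of two moments. -/
theorem integral_eq_moment_add {a b : ℝ} {F g h : ℝ → ℝ} (j : ℕ)
    (hg : ContinuousOn g (Icc 0 1)) (hh : ContinuousOn h (Icc 0 1))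
    (hF : ∀ τ ∈ Ioo (0 : ℝ) 1, (b - a) * F (a + (b - a) * τ)
      = τ ^ j * g τ + (b - a) * (τ ^ j * h τ)) :
    ∫ s in a..b, F s = moment j g + (b - a) * moment j h := by
  have e1 := intervalIntegral.smul_integral_comp_add_mul (a := 0) (b := 1) F (b - a) a
  rw [mul_zero, add_zero, mul_one, add_sub_cancel, smul_eq_mul] at e1
  rw [← e1, moment, moment, ← intervalIntegral.integral_const_mul,
    ← intervalIntegral.integral_const_mul,
    ← intervalIntegral.integral_add (intervalIntegrable_pow_smul hg j)
      ((intervalIntegrable_pow_smul hh j).const_mul _)]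
  refine intervalIntegral.integral_congr_ae ?_
  -- The end point is discarded: the two-sided derivative at a node also sees the next piece.
  filter_upwards [Measure.ae_ne volume (1 : ℝ)] with τ hτ1 hτ
  rw [uIoc_of_le zero_le_one] at hτ
  exact hF τ ⟨hτ.1, lt_of_le_of_ne hτ.2 hτ1⟩

end localization

/-! ### The bilinear form on one mesh interval -/

section forms

variable {d : ℕ} {Ω : Set (EuclideanSpace ℝ (Fin d))}

theorem energy_smul_right (x v : H01 Ω) (c : ℝ) : energy x (c • v) = c * energy x v :=
  real_inner_smul_right x.grad v.grad c

theorem inner_toL2_smul_right (g : L2 Ω) (v : H01 Ω) (c : ℝ) :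
    ⟪g, (c • v).toL2⟫_ℝ = c * ⟪g, v.toL2⟫_ℝ :=
  real_inner_smul_right g v.toL2 c

theorem energy_zero_right (x : H01 Ω) : energy x 0 = 0 := inner_zero_right x.grad

theorem inner_toL2_zero_right (g : L2 Ω) : ⟪g, (0 : H01 Ω).toL2⟫_ℝ = 0 := inner_zero_right g

/-- The bilinear form `(x, v) ↦ (P x, Q v)`. -/
noncomputable def innerComp {E Y : Type*} [NormedAddCommGroup E] [NormedSpace ℝ E]
    [NormedAddCommGroup Y] [InnerProductSpace ℝ Y] (P Q : E →L[ℝ] Y) : E →L[ℝ] E →L[ℝ] ℝ :=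
  (innerSL ℝ : Y →L[ℝ] Y →L[ℝ] ℝ).bilinearComp P Q

/-- The energy inner product `a(x₁, v₁) + (x₂, v₂)` on `H₀¹(Ω) × H₀¹(Ω)`. -/
noncomputable def formM : H01 Ω × H01 Ω →L[ℝ] H01 Ω × H01 Ω →L[ℝ] ℝ :=
  innerComp (H01.gradL.comp (ContinuousLinearMap.fst ℝ (H01 Ω) (H01 Ω)))
    (H01.gradL.comp (ContinuousLinearMap.fst ℝ (H01 Ω) (H01 Ω)))
  + innerComp (H01.toL2L.comp (ContinuousLinearMap.snd ℝ (H01 Ω) (H01 Ω)))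
    (H01.toL2L.comp (ContinuousLinearMap.snd ℝ (H01 Ω) (H01 Ω)))

/-- The form `a(x₁, v₂) - a(x₂, v₁)` on `H₀¹(Ω) × H₀¹(Ω)`. -/
noncomputable def formS : H01 Ω × H01 Ω →L[ℝ] H01 Ω × H01 Ω →L[ℝ] ℝ :=
  innerComp (H01.gradL.comp (ContinuousLinearMap.fst ℝ (H01 Ω) (H01 Ω)))
    (H01.gradL.comp (ContinuousLinearMap.snd ℝ (H01 Ω) (H01 Ω)))
  - innerComp (H01.gradL.comp (ContinuousLinearMap.snd ℝ (H01 Ω) (H01 Ω)))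
    (H01.gradL.comp (ContinuousLinearMap.fst ℝ (H01 Ω) (H01 Ω)))

theorem formM_apply (x v : H01 Ω × H01 Ω) :
    formM x v = energy x.1 v.1 + ⟪x.2.toL2, v.2.toL2⟫_ℝ := rfl

theorem formS_apply (x v : H01 Ω × H01 Ω) :
    formS x v = energy x.1 v.2 - energy x.2 v.1 := rfl

/-- The bilinear form on a mesh interval of length `k`, scaled to `[0, 1]` and tested with
`τ^j v`; the term with the value of `w` before the interval is left out. -/
noncomputable def stepForm (k : ℝ) (j : ℕ) (w : ℝ → H01 Ω × H01 Ω) (v : H01 Ω × H01 Ω) : ℝ :=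
  formM (w 1 - (j : ℝ) • moment (j - 1) w) v + k * formS (moment j w) v

set_option maxHeartbeats 1000000 in
-- Only the n-th integral survives. The time derivative absorbs the Jacobian of the scaling, so the
-- factor k stays with the skew form alone.
theorem sum_integral_bump {N : ℕ} {t : ℕ → ℝ} (ht : ∀ n < N, t n < t (n + 1)) {n : ℕ} (hn : n < N)
    (j : ℕ) {u₁ u₂ : ℝ → H01 Ω} {w : ℝ → H01 Ω × H01 Ω} (hw : ContDiffOn ℝ 1 w (Icc 0 1))
    (huw : ∀ τ ∈ Ioc (0 : ℝ) 1, (u₁ (t n + (t (n + 1) - t n) * τ),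
      u₂ (t n + (t (n + 1) - t n) * τ)) = w τ) (v : H01 Ω × H01 Ω) :
    (∑ m ∈ Finset.range N, ∫ s in (t m)..(t (m + 1)),
      (energy (deriv u₁ s) (bump t n j v.1 s) - energy (u₂ s) (bump t n j v.1 s)
        + ⟪(deriv u₂ s).toL2, (bump t n j v.2 s).toL2⟫_ℝ + energy (u₁ s) (bump t n j v.2 s)))
      = formM (moment j (derivWithin w (Icc 0 1))) v + (t (n + 1) - t n) * formS (moment j w) v := by
  have hwc := hw.continuousOn
  have hw'c : ContinuousOn (derivWithin w (Icc 0 1)) (Icc 0 1) :=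
    hw.continuousOn_derivWithin uniqueDiffOn_Icc_zero_one le_rfl
  have hk0 : 0 < t (n + 1) - t n := sub_pos.2 (ht n hn)
  have hder : ∀ τ ∈ Ioo (0 : ℝ) 1, derivWithin w (Icc 0 1) τ
      = (t (n + 1) - t n) • (deriv u₁ (t n + (t (n + 1) - t n) * τ),
        deriv u₂ (t n + (t (n + 1) - t n) * τ)) := by
    intro τ hτ
    have hd := ((hw.differentiableOn one_ne_zero) τ
      (Ioo_subset_Icc_self hτ)).hasDerivWithinAt
    have hu : UniqueDiffWithinAt ℝ (Icc (0 : ℝ) 1) τ :=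
      uniqueDiffOn_Icc_zero_one τ (Ioo_subset_Icc_self hτ)
    rw [Prod.smul_mk, smul_deriv_eq_derivWithin hw.fst (fun τ hτ => by rw [← huw τ hτ]) hτ,
      smul_deriv_eq_derivWithin hw.snd (fun τ hτ => by rw [← huw τ hτ]) hτ]
    exact Prod.ext (((ContinuousLinearMap.fst ℝ (H01 Ω) (H01 Ω)).hasFDerivAt.comp_hasDerivWithinAt
      τ hd).derivWithin hu).symm (((ContinuousLinearMap.snd ℝ (H01 Ω)
      (H01 Ω)).hasFDerivAt.comp_hasDerivWithinAt τ hd).derivWithin hu).symm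
  rw [Finset.sum_eq_single_of_mem n (Finset.mem_range.2 hn) fun m hm hmn => ?_,
    map_moment_left formM hw'c j v, map_moment_left formS hwc j v]
  · refine integral_eq_moment_add j (continuousOn_form_left formM hw'c v)
      (continuousOn_form_left formS hwc v) fun τ hτ => ?_
    have hs : t n + (t (n + 1) - t n) * τ ∈ Ioc (t n) (t (n + 1)) := by
      refine ⟨lt_add_of_pos_right _ (mul_pos hk0 hτ.1), ?_⟩
      have := mul_le_mul_of_nonneg_left hτ.2.le hk0.le
      linarith
    have eb : ∀ z : H01 Ω, bump t n j z (t n + (t (n + 1) - t n) * τ) = τ ^ j • z := by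
      intro z
      rw [bump, indicator_of_mem hs, add_sub_cancel_left, mul_div_cancel_left₀ _ hk0.ne']
    rw [hder τ hτ, ← huw τ (Ioo_subset_Ioc_self hτ), eb, eb, map_smul,
      smul_apply, formM_apply, formS_apply, energy_smul_right, energy_smul_right,
      energy_smul_right, inner_toL2_smul_right, smul_eq_mul]
    ring
  · refine intervalIntegral.integral_zero_ae (Filter.Eventually.of_forall fun s hs => ?_)
    have hm' := Finset.mem_range.1 hm
    rw [uIoc_of_le (ht m hm').le] at hs
    have b1 := bump_eq_zero_of_ne ht hm' hn hmn j v.1 hs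
    have b2 := bump_eq_zero_of_ne ht hm' hn hmn j v.2 hs
    rw [b1, b2, energy_zero_right, energy_zero_right, energy_zero_right, inner_toL2_zero_right]
    ring

set_option maxHeartbeats 1000000 in
-- The value w(0) produced by integration by parts cancels against w(0) in the jump, leaving the
-- incoming value. For n = 0 it cancels against the initial term, and nothing is subtracted, since
-- the initial data enter through the load.
theorem formB_bump {N : ℕ} {t : ℕ → ℝ} (ht : ∀ n < N, t n < t (n + 1)) {n : ℕ} (hn : n < N)
    (j : ℕ) {u₁ u₂ : ℝ → H01 Ω} {w : ℝ → H01 Ω × H01 Ω} (hw : ContDiffOn ℝ 1 w (Icc 0 1))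
    (huw : ∀ τ ∈ Ioc (0 : ℝ) 1, (u₁ (t n + (t (n + 1) - t n) * τ),
      u₂ (t n + (t (n + 1) - t n) * τ)) = w τ) (v : H01 Ω × H01 Ω) :
    formB N t u₁ u₂ (bump t n j v.1) (bump t n j v.2)
      = stepForm (t (n + 1) - t n) j w v
        - if n ≠ 0 ∧ j = 0 then formM (u₁ (t n), u₂ (t n)) v else 0 := by
  have hint := sum_integral_bump ht hn j hw huw v
  set k := t (n + 1) - t n with hk
  have hk0 : 0 < k := sub_pos.2 (ht n hn)
  have hwc := hw.continuousOn
  have hub : ∀ s ∈ Ioc (t n) (t (n + 1)), (u₁ s, u₂ s) = w ((s - t n) / k) := by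
    intro s hs
    have h := huw ((s - t n) / k) ⟨div_pos (sub_pos.2 hs.1) hk0,
      (div_le_one hk0).2 (sub_le_sub_right hs.2 _)⟩
    rwa [mul_div_cancel₀ _ hk0.ne', add_sub_cancel] at h
  have hwr : ContinuousWithinAt (fun s => w ((s - t n) / k)) (Icc (t n) (t (n + 1))) (t n) := by
    have h0 : ContinuousWithinAt w (Icc 0 1) ((t n - t n) / k) := by
      rw [sub_self, zero_div]
      exact hwc 0 (left_mem_Icc.2 zero_le_one)
    refine h0.comp (f := fun s => (s - t n) / k)
      (Continuous.continuousWithinAt (by fun_prop)) fun s hs => ?_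
    exact ⟨div_nonneg (sub_nonneg.2 hs.1) hk0.le, (div_le_one hk0).2 (sub_le_sub_right hs.2 _)⟩
  have hr1 : Function.rightLim u₁ (t n) = (w 0).1 := by
    rw [rightLim_eq_of_eqOn (ht n hn) (g := fun s => (w ((s - t n) / k)).1)
      (fun s hs => congrArg Prod.fst (hub s (Ioo_subset_Ioc_self hs))) hwr.fst, sub_self, zero_div]
  have hr2 : Function.rightLim u₂ (t n) = (w 0).2 := by
    rw [rightLim_eq_of_eqOn (ht n hn) (g := fun s => (w ((s - t n) / k)).2)
      (fun s hs => congrArg Prod.snd (hub s (Ioo_subset_Ioc_self hs))) hwr.snd, sub_self, zero_div]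
  have hb : ∀ m < N, ∀ x y : H01 Ω, energy x (Function.rightLim (bump t n j v.1) (t m))
      + ⟪y.toL2, (Function.rightLim (bump t n j v.2) (t m)).toL2⟫_ℝ
      = if m = n ∧ j = 0 then formM (x, y) v else 0 := by
    intro m hm x y
    rw [rightLim_bump ht hm hn, rightLim_bump ht hm hn]
    split_ifs
    · rfl
    · rw [energy_zero_right, inner_toL2_zero_right, add_zero]
  have lin : ∀ x y, formM (x - y) v = formM x v - formM y v := fun x y => by
    rw [map_sub, sub_apply]
  have e0 : formM (if j = 0 then w 0 else 0) v = if j = 0 then formM (w 0) v else 0 := by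
    split_ifs
    · rfl
    · rw [map_zero, zero_apply]
  rw [formB, hint, moment_derivWithin hw, add_assoc (_ + _), hb 0 (by omega),
    Finset.sum_congr rfl fun m hm => hb m (Finset.mem_Ico.1 hm).2 _ _, stepForm, sub_right_comm,
    lin _ (if j = 0 then w 0 else 0), e0]
  rcases Nat.eq_zero_or_pos n with rfl | hn0
  · rw [Finset.sum_eq_zero fun m hm => if_neg fun h => by
      have := (Finset.mem_Ico.1 hm).1
      omega, hr1, hr2, Prod.mk.eta]
    split_ifs <;> first | omega | ring1
  · have e : (jump u₁ (t n), jump u₂ (t n)) = w 0 - (u₁ (t n), u₂ (t n)) := by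
      rw [jump, jump, hr1, hr2]
      rfl
    rw [Finset.sum_eq_single_of_mem n (Finset.mem_Ico.2 ⟨hn0, hn⟩)
      fun m _ hmn => if_neg fun h => hmn h.1, e, lin (w 0)]
    split_ifs <;> first | omega | ring1

end forms

/-! ### Scaling to the unit interval -/

section scaling

variable {X : Type*} [NormedAddCommGroup X] [NormedSpace ℝ X] {N : ℕ} {t : ℕ → ℝ}

theorem mem_Ioc_of_scaled {a b τ : ℝ} (hab : a < b) (hτ : τ ∈ Ioc (0 : ℝ) 1) :
    a + (b - a) * τ ∈ Ioc a b := by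
  have h := sub_pos.2 hab
  refine ⟨lt_add_of_pos_right _ (mul_pos h hτ.1), ?_⟩
  have := mul_le_mul_of_nonneg_left hτ.2 h.le
  linarith

theorem mem_Icc_of_scaled {a b τ : ℝ} (hab : a < b) (hτ : τ ∈ Icc (0 : ℝ) 1) :
    a + (b - a) * τ ∈ Icc a b := by
  have h := sub_pos.2 hab
  refine ⟨le_add_of_nonneg_right (mul_nonneg h.le hτ.1), ?_⟩
  have := mul_le_mul_of_nonneg_left hτ.2 h.le
  linarith

theorem PiecewiseContDiff.exists_scaled {m : WithTop ℕ∞} {v : ℝ → X}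
    (hv : PiecewiseContDiff m N t v) {n : ℕ} (hn : n < N) (hlt : t n < t (n + 1)) :
    ∃ w : ℝ → X, ContDiffOn ℝ m w (Icc 0 1) ∧
      ∀ τ ∈ Ioc (0 : ℝ) 1, v (t n + (t (n + 1) - t n) * τ) = w τ := by
  obtain ⟨w, hw, hvw⟩ := hv n hn
  refine ⟨fun τ => w (t n + (t (n + 1) - t n) * τ), ?_, fun τ hτ =>
    hvw (mem_Ioc_of_scaled hlt hτ)⟩
  exact hw.comp (ContDiff.contDiffOn (by fun_prop)) fun τ hτ => mem_Icc_of_scaled hlt hτ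

open Polynomial in
theorem PiecewisePoly.exists_scaled {q : ℕ} {v : ℝ → X} (hv : PiecewisePoly q N t v) {n : ℕ}
    (hn : n < N) (hlt : t n < t (n + 1)) :
    ∃ a : ℕ → X, ∀ τ ∈ Ioc (0 : ℝ) 1, v (t n + (t (n + 1) - t n) * τ)
      = ∑ i ∈ Finset.range (q + 1), τ ^ i • a i := by
  obtain ⟨c, hc⟩ := hv n hn
  let p : ℕ → ℝ[X] := fun j => (C (t (n + 1) - t n) * Polynomial.X + C (t n)) ^ j
  have hp : ∀ j ∈ Finset.range (q + 1), (p j).natDegree < q + 1 := by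
    intro j hj
    have h1 : (p j).natDegree ≤ j * 1 := natDegree_pow_le_of_le j natDegree_linear_le
    have := Finset.mem_range.1 hj
    omega
  refine ⟨fun i => ∑ j ∈ Finset.range (q + 1), (p j).coeff i • c j, fun τ hτ => ?_⟩
  rw [hc (mem_Ioc_of_scaled hlt hτ)]
  simp only [Finset.smul_sum, smul_smul]
  rw [Finset.sum_comm]
  refine Finset.sum_congr rfl fun j hj => ?_
  rw [← Finset.sum_smul]
  congr 1
  simp_rw [mul_comm (τ ^ _)]
  rw [← eval_eq_sum_range' (hp j hj)]
  simp [p, add_comm]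

theorem iteratedDeriv_comp_add_mul (m : ℕ) (u : ℝ → X) (a k : ℝ) :
    iteratedDeriv m (fun τ => u (a + k * τ)) = fun τ => k ^ m • iteratedDeriv m u (a + k * τ) := by
  induction m with
  | zero => simp
  | succ m ih =>
    ext τ
    rw [iteratedDeriv_succ, ih, deriv_fun_const_smul_field, iteratedDeriv_succ,
      deriv_comp_mul_left k (fun s => iteratedDeriv m u (a + s)), deriv_comp_const_add, smul_smul,
      pow_succ]

theorem iteratedDerivWithin_eq_of_scaled (m : ℕ) {u w : ℝ → X} {a b : ℝ}
    (huw : ∀ τ ∈ Ioc (0 : ℝ) 1, u (a + (b - a) * τ) = w τ) {τ : ℝ} (hτ : τ ∈ Ioo (0 : ℝ) 1) :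
    iteratedDerivWithin m w (Icc 0 1) τ
      = (b - a) ^ m • iteratedDeriv m u (a + (b - a) * τ) := by
  have h1 : iteratedDerivWithin m w (Icc 0 1) τ = iteratedDeriv m w τ := by
    rw [iteratedDerivWithin, iteratedDeriv, ← iteratedFDerivWithin_univ,
      iteratedFDerivWithin_congr_set]
    exact Filter.eventuallyEq_univ.2 (Icc_mem_nhds hτ.1 hτ.2)
  have h2 : w =ᶠ[nhds τ] fun τ => u (a + (b - a) * τ) := by
    filter_upwards [Ioo_mem_nhds hτ.1 hτ.2] with s hs using (huw s (Ioo_subset_Ioc_self hs)).symm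
  rw [h1, h2.iteratedDeriv_eq, iteratedDeriv_comp_add_mul]

/-- The m derivatives contribute k^m, and the factor k on the left is the Jacobian of the
substitution. -/
theorem mul_integral_norm_iteratedDerivWithin {X₁ X₂ Y₁ Y₂ : Type*}
    [NormedAddCommGroup X₁] [NormedSpace ℝ X₁] [NormedAddCommGroup X₂] [NormedSpace ℝ X₂]
    [NormedAddCommGroup Y₁] [NormedSpace ℝ Y₁] [NormedAddCommGroup Y₂] [NormedSpace ℝ Y₂]
    (T₁ : X₁ →L[ℝ] Y₁) (T₂ : X₂ →L[ℝ] Y₂) (m : ℕ) {u₁ w₁ : ℝ → X₁} {u₂ w₂ : ℝ → X₂} {a b : ℝ}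
    (hab : a < b) (hw₁ : ContDiffOn ℝ m w₁ (Icc 0 1)) (hw₂ : ContDiffOn ℝ m w₂ (Icc 0 1))
    (huw₁ : ∀ τ ∈ Ioc (0 : ℝ) 1, u₁ (a + (b - a) * τ) = w₁ τ)
    (huw₂ : ∀ τ ∈ Ioc (0 : ℝ) 1, u₂ (a + (b - a) * τ) = w₂ τ) :
    (b - a) * ((∫ τ in (0 : ℝ)..1, ‖T₁ (iteratedDerivWithin m w₁ (Icc 0 1) τ)‖)
        + ∫ τ in (0 : ℝ)..1, ‖T₂ (iteratedDerivWithin m w₂ (Icc 0 1) τ)‖)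
      = (b - a) ^ m * ∫ s in a..b, (‖T₂ (iteratedDeriv m u₂ s)‖ + ‖T₁ (iteratedDeriv m u₁ s)‖) := by
  have h0 := sub_pos.2 hab
  have c1 := (T₁.continuous.comp_continuousOn
    (hw₁.continuousOn_iteratedDerivWithin le_rfl uniqueDiffOn_Icc_zero_one)).norm
  have c2 := (T₂.continuous.comp_continuousOn
    (hw₂.continuousOn_iteratedDerivWithin le_rfl uniqueDiffOn_Icc_zero_one)).norm
  have e1 := intervalIntegral.smul_integral_comp_add_mul (a := 0) (b := 1)
    (fun s => ‖T₂ (iteratedDeriv m u₂ s)‖ + ‖T₁ (iteratedDeriv m u₁ s)‖) (b - a) a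
  rw [mul_zero, add_zero, mul_one, add_sub_cancel, smul_eq_mul] at e1
  have e2 := intervalIntegral.integral_add (c1.intervalIntegrable_of_Icc zero_le_one)
    (c2.intervalIntegrable_of_Icc zero_le_one) (μ := volume)
  simp only [Function.comp_apply] at e2
  rw [← e1, ← e2, mul_left_comm, ← intervalIntegral.integral_const_mul ((b - a) ^ m)]
  congr 1
  refine intervalIntegral.integral_congr_ae ?_
  filter_upwards [Measure.ae_ne volume (1 : ℝ)] with τ hτ1 hτ
  rw [uIoc_of_le zero_le_one] at hτ
  have hτ' : τ ∈ Ioo (0 : ℝ) 1 := ⟨hτ.1, lt_of_le_of_ne hτ.2 hτ1⟩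
  rw [iteratedDerivWithin_eq_of_scaled m huw₁ hτ', iteratedDerivWithin_eq_of_scaled m huw₂ hτ',
    map_smul, map_smul, norm_smul, norm_smul, Real.norm_of_nonneg (by positivity)]
  ring

/-- The moments of a pair of functions. -/
theorem moment_prodMk {X' : Type*} [NormedAddCommGroup X'] [NormedSpace ℝ X'] [CompleteSpace X]
    [CompleteSpace X'] {f : ℝ → X} {g : ℝ → X'} (hf : ContinuousOn f (Icc 0 1))
    (hg : ContinuousOn g (Icc 0 1)) (j : ℕ) :
    moment j (fun τ => (f τ, g τ)) = (moment j f, moment j g) :=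
  Prod.ext (map_moment (hf.prodMk hg) j (ContinuousLinearMap.fst ℝ X X'))
    (map_moment (hf.prodMk hg) j (ContinuousLinearMap.snd ℝ X X'))

/-- The first-order part sees only the end value and the moment of order j - 1 < q, so passing to
the projection costs nothing there. For j = 0 the truncated index is harmless because its factor is
0. -/
theorem sub_smul_moment_eq_sum {q : ℕ} {w : ℝ → X} {a : ℕ → X}
    (h1 : ∑ i ∈ Finset.range (q + 1), a i = w 1)
    (hm : ∀ k < q, ∑ i ∈ Finset.range (q + 1), (1 / ((i : ℝ) + k + 1)) • a i = moment k w)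
    {j : ℕ} (hj : j ∈ Finset.range (q + 1)) :
    w 1 - (j : ℝ) • moment (j - 1) w
      = ∑ i ∈ Finset.range (q + 1), (1 - (j : ℝ) / ((i : ℝ) + j)) • a i := by
  rcases j with _ | j
  · simp [h1]
  · rw [add_tsub_cancel_right, ← hm j (by simpa using hj), ← h1, Finset.smul_sum,
      ← Finset.sum_sub_distrib]
    refine Finset.sum_congr rfl fun i _ => ?_
    rw [smul_smul, sub_smul, one_smul]
    push_cast
    rw [mul_one_div, add_assoc]

end scaling

/-! ### The error over one mesh interval -/

/-- The error bound over one mesh interval, scaled to `[0, 1]`: `Σ τ^i a_i` is the discrete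
solution, `P (w₁, w₂)` the exact one, and `e` the error at the start of the interval. The problem
is skew-symmetric in the semi-norm `‖J ·‖` after the test functions are transformed by `S`. -/
theorem exists_scaled_step_le (q : ℕ) : ∃ C : ℝ, 0 < C ∧
    ∀ {E X₁ X₂ Y Y₁ Y₂ : Type} [NormedAddCommGroup E] [NormedSpace ℝ E] [CompleteSpace E]
      [NormedAddCommGroup X₁] [NormedSpace ℝ X₁] [CompleteSpace X₁]
      [NormedAddCommGroup X₂] [NormedSpace ℝ X₂] [CompleteSpace X₂]
      [NormedAddCommGroup Y] [InnerProductSpace ℝ Y]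
      [NormedAddCommGroup Y₁] [NormedSpace ℝ Y₁] [CompleteSpace Y₁]
      [NormedAddCommGroup Y₂] [NormedSpace ℝ Y₂] [CompleteSpace Y₂]
      (M B : E →L[ℝ] E →L[ℝ] ℝ) (J : E →ₗ[ℝ] Y) (S : E →ₗ[ℝ] E) (P : X₁ × X₂ →L[ℝ] E)
      (T₁ : X₁ →L[ℝ] Y₁) (T₂ : X₂ →L[ℝ] Y₂)
      (_ : ∀ x v, M x (S v) = ⟪J x, J v⟫_ℝ) (_ : ∀ x, B x (S x) = 0)
      (_ : ∀ x₁ x₂ v, |B (P (x₁, x₂)) (S v)| ≤ (‖T₁ x₁‖ + ‖T₂ x₂‖) * ‖J v‖)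
      {k : ℝ} (_ : 0 ≤ k) {w₁ : ℝ → X₁} {w₂ : ℝ → X₂}
      (_ : ContDiffOn ℝ ((q + 1 : ℕ) : WithTop ℕ∞) w₁ (Icc 0 1))
      (_ : ContDiffOn ℝ ((q + 1 : ℕ) : WithTop ℕ∞) w₂ (Icc 0 1)) {W : ℝ → E} {a : ℕ → E}
      (_ : ∀ τ, W τ = ∑ i ∈ Finset.range (q + 1), τ ^ i • a i) (e : E)
      (_ : ∀ j ≤ q, ∀ v, M (W 1 - (j : ℝ) • moment (j - 1) W) v + k * B (moment j W) v
        = M (P (w₁ 1, w₂ 1) - (j : ℝ) • moment (j - 1) fun τ => P (w₁ τ, w₂ τ)) v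
          + k * B (moment j fun τ => P (w₁ τ, w₂ τ)) v + if j = 0 then M e v else 0),
      ‖J (W 1 - P (w₁ 1, w₂ 1))‖ ≤ ‖J e‖ + C * (k *
        ((∫ τ in (0 : ℝ)..1, ‖T₁ (iteratedDerivWithin (q + 1) w₁ (Icc 0 1) τ)‖)
          + ∫ τ in (0 : ℝ)..1, ‖T₂ (iteratedDerivWithin (q + 1) w₂ (Icc 0 1) τ)‖)) := by
  obtain ⟨C₁, hC₁, hstep⟩ := exists_norm_step_le.{0, 0} q
  obtain ⟨C₂, hC₂, hproj⟩ := exists_projection.{0, 0} q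
  refine ⟨C₁ * C₂, by positivity, ?_⟩
  intro E X₁ X₂ Y Y₁ Y₂ _ _ _ _ _ _ _ _ _ _ _ _ _ _ _ _ _ M B J S P T₁ T₂ hJ hS hT k hk w₁ w₂
    hw₁ hw₂ W a hW e heq
  obtain ⟨c₁, hc₁, hm₁, hb₁⟩ := hproj w₁ hw₁
  obtain ⟨c₂, hc₂, hm₂, hb₂⟩ := hproj w₂ hw₂
  have hwc : ContinuousOn (fun τ => (w₁ τ, w₂ τ)) (Icc 0 1) :=
    hw₁.continuousOn.prodMk hw₂.continuousOn
  have hmw : ∀ j, moment j (fun τ => P (w₁ τ, w₂ τ)) = P (moment j w₁, moment j w₂) := fun j => by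
    rw [← moment_prodMk hw₁.continuousOn hw₂.continuousOn, map_moment hwc j P]
  have hpsum : ∀ b : ℕ → ℝ, ∑ i ∈ Finset.range (q + 1), b i • P (c₁ i, c₂ i)
      = P (∑ i ∈ Finset.range (q + 1), b i • c₁ i, ∑ i ∈ Finset.range (q + 1), b i • c₂ i) := by
    intro b
    simp only [← map_smul, ← map_sum]
    congr 1
    exact Prod.ext (by simp [Prod.fst_sum]) (by simp [Prod.snd_sum])
  have hp1 : ∑ i ∈ Finset.range (q + 1), P (c₁ i, c₂ i) = P (w₁ 1, w₂ 1) := by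
    have := hpsum fun _ => 1
    simpa [hc₁, hc₂] using this
  have hpm : ∀ l < q, ∑ i ∈ Finset.range (q + 1), (1 / ((i : ℝ) + l + 1)) • P (c₁ i, c₂ i)
      = moment l fun τ => P (w₁ τ, w₂ τ) := by
    intro l hl
    rw [hpsum, hmw, hm₁ l hl, hm₂ l hl]
  have ha1 : ∑ i ∈ Finset.range (q + 1), a i = W 1 := by
    simp [hW]
  have ham : ∀ l, moment l W = ∑ i ∈ Finset.range (q + 1), (1 / ((i : ℝ) + l + 1)) • a i :=
    fun l => by rw [funext hW, moment_sum_pow]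
  set δ₁ := moment q w₁ - ∑ i ∈ Finset.range (q + 1), (1 / ((i : ℝ) + q + 1)) • c₁ i with hδ₁
  set δ₂ := moment q w₂ - ∑ i ∈ Finset.range (q + 1), (1 / ((i : ℝ) + q + 1)) • c₂ i with hδ₂
  have hpq : moment q (fun τ => P (w₁ τ, w₂ τ)) = ∑ i ∈ Finset.range (q + 1),
      (1 / ((i : ℝ) + q + 1)) • P (c₁ i, c₂ i) + P (δ₁, δ₂) := by
    rw [hpsum, hmw, ← map_add, Prod.mk_add_mk, hδ₁, hδ₂, add_sub_cancel, add_sub_cancel]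
  -- The moments of order below q are preserved, so the data live in the equation j = q alone.
  let F : ℕ → E → ℝ := fun j v => if j = q then k * B (P (δ₁, δ₂)) (S v) else 0
  let ℓ : E →ₗ[ℝ] E →ₗ[ℝ] ℝ := LinearMap.mk₂ ℝ (fun x v => k * B x (S v))
    (fun x y v => by simp [mul_add]) (fun c x v => by simp [mul_left_comm])
    (fun x v y => by simp [mul_add]) (fun c x v => by simp [mul_left_comm])
  have hlast := hstep J ℓ (fun x => by simp [ℓ, hS]) (fun i => a i - P (c₁ i, c₂ i)) e F
    (k * (‖T₁ δ₁‖ + ‖T₂ δ₂‖)) (by positivity) ?_ ?_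
  · rw [Finset.sum_sub_distrib, ha1, hp1] at hlast
    refine hlast.trans ?_
    rw [mul_assoc C₁, mul_left_comm C₂, mul_add C₂]
    gcongr
    · exact hb₁ T₁
    · exact hb₂ T₂
  · intro j hj v
    simp only [F]
    split_ifs
    · rw [abs_mul, abs_of_nonneg hk, mul_assoc]
      exact mul_le_mul_of_nonneg_left (hT δ₁ δ₂ v) hk
    · rw [abs_zero]
      positivity
  · intro j hj v
    have h := heq j (Nat.lt_succ_iff.1 (Finset.mem_range.1 hj)) (S v)
    rw [sub_smul_moment_eq_sum ha1 (fun l _ => (ham l).symm) hj,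
      sub_smul_moment_eq_sum (w := fun τ => P (w₁ τ, w₂ τ)) hp1 hpm hj, ham] at h
    have h2 : B (moment j fun τ => P (w₁ τ, w₂ τ)) (S v)
        = B (∑ i ∈ Finset.range (q + 1), (1 / ((i : ℝ) + j + 1)) • P (c₁ i, c₂ i)) (S v)
          + if j = q then B (P (δ₁, δ₂)) (S v) else 0 := by
      split_ifs with hjq
      · rw [hjq, hpq, map_add, add_apply]
      · have := Finset.mem_range.1 hj
        rw [hpm j (by omega), add_zero]
    rw [h2, hJ, hJ, hJ] at h
    simp only [F, ℓ, LinearMap.mk₂_apply, smul_sub, Finset.sum_sub_distrib, map_sub,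
      inner_sub_left, LinearMap.sub_apply]
    split_ifs at h ⊢ <;> linear_combination h

section error

variable {d : ℕ} {Ω : Set (EuclideanSpace ℝ (Fin d))}

theorem continuous_stepForm (k : ℝ) (j : ℕ) (w : ℝ → H01 Ω × H01 Ω) :
    Continuous (stepForm k j w) :=
  (ContinuousLinearMap.continuous _).add (continuous_const.mul (ContinuousLinearMap.continuous _))

set_option maxHeartbeats 1000000 in
/-- On each mesh interval the discrete and the exact solution satisfy the same equation, for all
test functions that are polynomials of degree at most `q` with values in `H₀¹(Ω)`. -/
theorem stepForm_eq_stepForm (hΩ : IsOpen Ω) {T : ℝ} {N : ℕ} {t : ℕ → ℝ} (ht : IsMesh T N t)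
    {q : ℕ} {f : ℝ → L2 Ω} {u₀ v₀ : H01 Ω} {U₁ U₂ : ℝ → H01 Ω}
    (hU : IsDGSolution q N t f u₀ v₀ U₁ U₂) {m : WithTop ℕ∞} {u₁ : ℝ → DomA Ω} {u₂ : ℝ → H01 Ω}
    (hu : IsSolution m N t f u₀ v₀ u₁ u₂) {n : ℕ} (hn : n < N)
    {w W : ℝ → H01 Ω × H01 Ω} (hw : ContDiffOn ℝ 1 w (Icc 0 1)) (hW : ContDiffOn ℝ 1 W (Icc 0 1))
    (huw : ∀ τ ∈ Ioc (0 : ℝ) 1, ((u₁ (t n + (t (n + 1) - t n) * τ)).toH01,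
      u₂ (t n + (t (n + 1) - t n) * τ)) = w τ)
    (hUW : ∀ τ ∈ Ioc (0 : ℝ) 1, (U₁ (t n + (t (n + 1) - t n) * τ),
      U₂ (t n + (t (n + 1) - t n) * τ)) = W τ)
    {j : ℕ} (hj : j ≤ q) (v : H01 Ω × H01 Ω) :
    stepForm (t (n + 1) - t n) j W v
      = stepForm (t (n + 1) - t n) j w v
        + if j = 0 then formM (U₁ (t n) - (u₁ (t n)).toH01, U₂ (t n) - u₂ (t n)) v else 0 := by
  set e : H01 Ω × H01 Ω := (U₁ (t n) - (u₁ (t n)).toH01, U₂ (t n) - u₂ (t n)) with he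
  -- The exact solution is tested only with values in dom(A); both sides are continuous in v, so
  -- density extends the identity to H₀¹.
  have hdense := (DomA.denseRange_toH01 hΩ).prodMap (DomA.denseRange_toH01 hΩ)
  have hc : Continuous fun v => stepForm (t (n + 1) - t n) j w v
      + if j = 0 then formM e v else 0 := by
    refine (continuous_stepForm _ _ _).add ?_
    split_ifs
    · exact (formM e).continuous
    · exact continuous_const
  refine congrFun (hdense.equalizer (continuous_stepForm _ _ _) hc (funext fun z => ?_)) v
  have b1 := formB_bump ht.lt hn j hW hUW (z.1.toH01, z.2.toH01)
  have b2 := formB_bump (u₁ := fun s => (u₁ s).toH01) ht.lt hn j hw huw (z.1.toH01, z.2.toH01)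
  have b3 := hU.eq _ _ (piecewisePoly_bump ht.lt hn hj z.1.toH01)
    (piecewisePoly_bump ht.lt hn hj z.2.toH01)
  have b4 := hu.eq _ _ (piecewiseContDiff_bump ht.lt hn j z.1)
    (piecewiseContDiff_bump ht.lt hn j z.2)
  have e1 : ∀ z : DomA Ω, (fun s => (bump t n j z s).toH01) = bump t n j z.toH01 := fun z =>
    funext fun s => map_bump DomA.toH01L n j z s
  rw [e1, e1] at b4
  rw [← b4, b1, b2] at b3
  change stepForm (t (n + 1) - t n) j W (z.1.toH01, z.2.toH01)
    = stepForm (t (n + 1) - t n) j w (z.1.toH01, z.2.toH01)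
      + if j = 0 then formM e (z.1.toH01, z.2.toH01) else 0
  have e2 : formM e (z.1.toH01, z.2.toH01) = formM (U₁ (t n), U₂ (t n)) (z.1.toH01, z.2.toH01)
      - formM ((u₁ (t n)).toH01, u₂ (t n)) (z.1.toH01, z.2.toH01) := by
    rw [← sub_apply, ← map_sub]
    rfl
  -- On the first interval no incoming value is subtracted in `formB_bump`; this agrees with the
  -- stated form because both solutions start from the same data.
  have e3 : n = 0 → e = 0 := by
    rintro rfl
    rw [he, ht.zero, hU.init₁, hU.init₂, hu.init₁, hu.init₂, sub_self, sub_self]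
    rfl
  have e4 : n = 0 → formM e (z.1.toH01, z.2.toH01) = 0 := fun h => by
    rw [e3 h, map_zero, zero_apply]
  generalize formM e (z.1.toH01, z.2.toH01) = x1 at *
  generalize formM (U₁ (t n), U₂ (t n)) (z.1.toH01, z.2.toH01) = x2 at *
  generalize formM ((u₁ (t n)).toH01, u₂ (t n)) (z.1.toH01, z.2.toH01) = x3 at *
  generalize stepForm (t (n + 1) - t n) j W (z.1.toH01, z.2.toH01) = x4 at *
  generalize stepForm (t (n + 1) - t n) j w (z.1.toH01, z.2.toH01) = x5 at *
  clear b1 b2 b4 hc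
  by_cases hj0 : j = 0
  · by_cases hn0 : n = 0
    · simp only [hj0, hn0, ne_eq, not_true_eq_false, false_and, if_false, sub_zero, if_true] at b3 ⊢
      linarith [e4 hn0]
    · simp only [hj0, hn0, ne_eq, not_false_eq_true, true_and, if_true] at b3 ⊢
      linarith
  · simp only [hj0, and_false, if_false] at b3 ⊢
    linarith

set_option maxHeartbeats 1000000 in
/-- The error bound over one mesh interval, in a semi-norm `‖J ·‖` in which the problem is
skew-symmetric after the test functions are transformed by `S`. -/
theorem exists_error_step_le (q : ℕ) : ∃ C : ℝ, 0 < C ∧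
    ∀ {d : ℕ} {Ω : Set (EuclideanSpace ℝ (Fin d))} (_ : IsOpen Ω) {T : ℝ} {N : ℕ} {t : ℕ → ℝ}
      (_ : IsMesh T N t) {f : ℝ → L2 Ω} {u₀ v₀ : H01 Ω} {U₁ U₂ : ℝ → H01 Ω}
      (_ : IsDGSolution q N t f u₀ v₀ U₁ U₂) {u₁ : ℝ → DomA Ω} {u₂ : ℝ → H01 Ω}
      (_ : IsSolution ((q + 1 : ℕ) : WithTop ℕ∞) N t f u₀ v₀ u₁ u₂)
      {Y Y₁ Y₂ : Type} [NormedAddCommGroup Y] [InnerProductSpace ℝ Y]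
      [NormedAddCommGroup Y₁] [NormedSpace ℝ Y₁] [CompleteSpace Y₁]
      [NormedAddCommGroup Y₂] [NormedSpace ℝ Y₂] [CompleteSpace Y₂]
      (J : H01 Ω × H01 Ω →ₗ[ℝ] Y) (S : H01 Ω × H01 Ω →ₗ[ℝ] H01 Ω × H01 Ω)
      (T₁ : DomA Ω →L[ℝ] Y₁) (T₂ : H01 Ω →L[ℝ] Y₂)
      (_ : ∀ x v, formM x (S v) = ⟪J x, J v⟫_ℝ) (_ : ∀ x, formS x (S x) = 0)
      (_ : ∀ (x₁ : DomA Ω) (x₂ : H01 Ω) v,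
        |formS (x₁.toH01, x₂) (S v)| ≤ (‖T₁ x₁‖ + ‖T₂ x₂‖) * ‖J v‖)
      (n : ℕ) (_ : n < N),
      ‖J (U₁ (t (n + 1)) - (u₁ (t (n + 1))).toH01, U₂ (t (n + 1)) - u₂ (t (n + 1)))‖
        ≤ ‖J (U₁ (t n) - (u₁ (t n)).toH01, U₂ (t n) - u₂ (t n))‖
          + C * ((t (n + 1) - t n) ^ (q + 1) * ∫ s in (t n)..(t (n + 1)),
            (‖T₂ (iteratedDeriv (q + 1) u₂ s)‖ + ‖T₁ (iteratedDeriv (q + 1) u₁ s)‖)) := by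
  obtain ⟨C, hC, hstep⟩ := exists_scaled_step_le q
  refine ⟨C, hC, ?_⟩
  intro d Ω hΩ T N t ht f u₀ v₀ U₁ U₂ hU u₁ u₂ hu Y Y₁ Y₂ _ _ _ _ _ _ _ _ J S T₁ T₂ hJ hS hT n hn
  have hlt := ht.lt n hn
  obtain ⟨a₁, ha₁⟩ := hU.poly₁.exists_scaled hn hlt
  obtain ⟨a₂, ha₂⟩ := hU.poly₂.exists_scaled hn hlt
  obtain ⟨w₁, hw₁, huw₁⟩ := hu.smooth₁.exists_scaled hn hlt
  obtain ⟨w₂, hw₂, huw₂⟩ := hu.smooth₂.exists_scaled hn hlt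
  have hint := mul_integral_norm_iteratedDerivWithin T₁ T₂ (q + 1) hlt hw₁ hw₂ huw₁ huw₂
  let P : DomA Ω × H01 Ω →L[ℝ] H01 Ω × H01 Ω :=
    DomA.toH01L.prodMap (ContinuousLinearMap.id ℝ (H01 Ω))
  let W : ℝ → H01 Ω × H01 Ω := fun τ => ∑ i ∈ Finset.range (q + 1), τ ^ i • (a₁ i, a₂ i)
  have h1 : (1 : ℝ) ∈ Ioc (0 : ℝ) 1 := right_mem_Ioc.2 zero_lt_one
  have hWd : ContDiff ℝ 1 W :=
    ContDiff.sum fun i _ => (contDiff_id.pow i).smul contDiff_const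
  have hwd : ContDiffOn ℝ 1 (fun τ => P (w₁ τ, w₂ τ)) (Icc 0 1) :=
    P.contDiff.comp_contDiffOn ((hw₁.prodMk hw₂).of_le (by norm_cast; omega))
  have huw : ∀ τ ∈ Ioc (0 : ℝ) 1, ((u₁ (t n + (t (n + 1) - t n) * τ)).toH01,
      u₂ (t n + (t (n + 1) - t n) * τ)) = P (w₁ τ, w₂ τ) :=
    fun τ hτ => by rw [huw₁ τ hτ, huw₂ τ hτ]; rfl
  have hUW : ∀ τ ∈ Ioc (0 : ℝ) 1, (U₁ (t n + (t (n + 1) - t n) * τ),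
      U₂ (t n + (t (n + 1) - t n) * τ)) = W τ := fun τ hτ => by
    rw [ha₁ τ hτ, ha₂ τ hτ]
    exact Prod.ext (by simp only [W, Prod.fst_sum, Prod.smul_mk])
      (by simp only [W, Prod.snd_sum, Prod.smul_mk])
  have h := hstep formM formS J S P T₁ T₂ hJ hS hT (sub_pos.2 hlt).le hw₁ hw₂ (W := W)
    (fun τ => rfl) (U₁ (t n) - (u₁ (t n)).toH01, U₂ (t n) - u₂ (t n))
    (fun j hj v => stepForm_eq_stepForm hΩ ht hU hu hn hwd hWd.contDiffOn huw hUW hj v)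
  rw [hint, ← hUW 1 h1, ← huw 1 h1, mul_one, add_sub_cancel] at h
  exact h

end error

/-! ### Summation over the steps and the two energy norms -/

noncomputable section energyNorms

variable {d : ℕ} {Ω : Set (EuclideanSpace ℝ (Fin d))}

/-- The map `x ↦ (P₁ x, P₂ x)` into the Hilbert sum of two inner product spaces. -/
def hilbertProd {E Y₁ Y₂ : Type} [AddCommGroup E] [Module ℝ E]
    [NormedAddCommGroup Y₁] [InnerProductSpace ℝ Y₁]
    [NormedAddCommGroup Y₂] [InnerProductSpace ℝ Y₂] (P₁ : E →ₗ[ℝ] Y₁) (P₂ : E →ₗ[ℝ] Y₂) :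
    E →ₗ[ℝ] WithLp 2 (Y₁ × Y₂) :=
  (WithLp.linearEquiv 2 ℝ (Y₁ × Y₂)).symm.toLinearMap ∘ₗ P₁.prod P₂

section hilbertProd

variable {E Y₁ Y₂ : Type} [AddCommGroup E] [Module ℝ E]
    [NormedAddCommGroup Y₁] [InnerProductSpace ℝ Y₁]
    [NormedAddCommGroup Y₂] [InnerProductSpace ℝ Y₂] (P₁ : E →ₗ[ℝ] Y₁) (P₂ : E →ₗ[ℝ] Y₂)

theorem norm_le_hilbertProd_fst (x : E) : ‖P₁ x‖ ≤ ‖hilbertProd P₁ P₂ x‖ :=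
  WithLp.norm_fst_le (p := 2) (x := hilbertProd P₁ P₂ x)

theorem norm_le_hilbertProd_snd (x : E) : ‖P₂ x‖ ≤ ‖hilbertProd P₁ P₂ x‖ :=
  WithLp.norm_snd_le (p := 2) (x := hilbertProd P₁ P₂ x)

theorem abs_inner_sub_inner_le (y₁ : Y₁) (y₂ : Y₂) (v : E) :
    |⟪y₂, P₂ v⟫_ℝ - ⟪y₁, P₁ v⟫_ℝ| ≤ (‖y₂‖ + ‖y₁‖) * ‖hilbertProd P₁ P₂ v‖ := by
  rw [add_mul]
  refine (abs_sub _ _).trans (add_le_add ?_ ?_)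
  · exact (abs_real_inner_le_norm _ _).trans
      (mul_le_mul_of_nonneg_left (norm_le_hilbertProd_snd P₁ P₂ v) (norm_nonneg _))
  · exact (abs_real_inner_le_norm _ _).trans
      (mul_le_mul_of_nonneg_left (norm_le_hilbertProd_fst P₁ P₂ v) (norm_nonneg _))

end hilbertProd

/-- The error bound at the final time in a semi-norm `‖J ·‖` in which the problem is
skew-symmetric after the test functions are transformed by `S`. -/
theorem exists_error_le (q : ℕ) : ∃ C : ℝ, 0 < C ∧
    ∀ {d : ℕ} {Ω : Set (EuclideanSpace ℝ (Fin d))} (_ : IsOpen Ω) {T : ℝ} {N : ℕ} {t : ℕ → ℝ}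
      (_ : IsMesh T N t) {f : ℝ → L2 Ω} {u₀ v₀ : H01 Ω} {U₁ U₂ : ℝ → H01 Ω}
      (_ : IsDGSolution q N t f u₀ v₀ U₁ U₂) {u₁ : ℝ → DomA Ω} {u₂ : ℝ → H01 Ω}
      (_ : IsSolution ((q + 1 : ℕ) : WithTop ℕ∞) N t f u₀ v₀ u₁ u₂)
      {Y Y₁ Y₂ : Type} [NormedAddCommGroup Y] [InnerProductSpace ℝ Y]
      [NormedAddCommGroup Y₁] [NormedSpace ℝ Y₁] [CompleteSpace Y₁]
      [NormedAddCommGroup Y₂] [NormedSpace ℝ Y₂] [CompleteSpace Y₂]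
      (J : H01 Ω × H01 Ω →ₗ[ℝ] Y) (S : H01 Ω × H01 Ω →ₗ[ℝ] H01 Ω × H01 Ω)
      (T₁ : DomA Ω →L[ℝ] Y₁) (T₂ : H01 Ω →L[ℝ] Y₂)
      (_ : ∀ x v, formM x (S v) = ⟪J x, J v⟫_ℝ) (_ : ∀ x, formS x (S x) = 0)
      (_ : ∀ (x₁ : DomA Ω) (x₂ : H01 Ω) v,
        |formS (x₁.toH01, x₂) (S v)| ≤ (‖T₁ x₁‖ + ‖T₂ x₂‖) * ‖J v‖),
      ‖J (U₁ (t N) - (u₁ (t N)).toH01, U₂ (t N) - u₂ (t N))‖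
        ≤ C * ∑ n ∈ Finset.range N, (t (n + 1) - t n) ^ (q + 1) * ∫ s in (t n)..(t (n + 1)),
            (‖T₂ (iteratedDeriv (q + 1) u₂ s)‖ + ‖T₁ (iteratedDeriv (q + 1) u₁ s)‖) := by
  obtain ⟨C, hC, hstep⟩ := exists_error_step_le q
  refine ⟨C, hC, ?_⟩
  intro d Ω hΩ T N t ht f u₀ v₀ U₁ U₂ hU u₁ u₂ hu Y Y₁ Y₂ _ _ _ _ _ _ _ _ J S T₁ T₂ hJ hS hT
  -- The incoming error carries the factor 1, so the local bounds simply add up.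
  have key : ∀ m ≤ N, ‖J (U₁ (t m) - (u₁ (t m)).toH01, U₂ (t m) - u₂ (t m))‖
      ≤ C * ∑ n ∈ Finset.range m, (t (n + 1) - t n) ^ (q + 1) * ∫ s in (t n)..(t (n + 1)),
        (‖T₂ (iteratedDeriv (q + 1) u₂ s)‖ + ‖T₁ (iteratedDeriv (q + 1) u₁ s)‖) := by
    intro m
    induction m with
    | zero =>
      intro _
      rw [ht.zero, hU.init₁, hU.init₂, hu.init₁, hu.init₂, sub_self, sub_self,
        Finset.sum_range_zero, mul_zero]
      exact (norm_eq_zero.2 (map_zero J)).le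
    | succ m ih =>
      intro hm
      rw [Finset.sum_range_succ, mul_add]
      exact (hstep hΩ ht hU hu J S T₁ T₂ hJ hS hT m hm).trans
        (add_le_add_left (ih (Nat.le_of_succ_le hm)) _)
  exact key N le_rfl

/-- `(x₁, x₂) ↦ ∇x₁`. -/
def gradFst (Ω : Set (EuclideanSpace ℝ (Fin d))) : H01 Ω × H01 Ω →ₗ[ℝ] L2Vec Ω :=
  H01.gradL.toLinearMap ∘ₗ LinearMap.fst ℝ _ _

/-- `(x₁, x₂) ↦ x₁` as a function in `L²(Ω)`. -/
def toL2Fst (Ω : Set (EuclideanSpace ℝ (Fin d))) : H01 Ω × H01 Ω →ₗ[ℝ] L2 Ω :=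
  H01.toL2L.toLinearMap ∘ₗ LinearMap.fst ℝ _ _

/-- `(x₁, x₂) ↦ x₂` as a function in `L²(Ω)`. -/
def toL2Snd (Ω : Set (EuclideanSpace ℝ (Fin d))) : H01 Ω × H01 Ω →ₗ[ℝ] L2 Ω :=
  H01.toL2L.toLinearMap ∘ₗ LinearMap.snd ℝ _ _

/-- `(x₁, x₂) ↦ (∇x₁, x₂)`, whose norm is the energy norm. -/
def energyMap (Ω : Set (EuclideanSpace ℝ (Fin d))) :
    H01 Ω × H01 Ω →ₗ[ℝ] WithLp 2 (L2Vec Ω × L2 Ω) :=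
  hilbertProd (gradFst Ω) (toL2Snd Ω)

/-- `(x₁, x₂) ↦ (x₁, ∇Rx₂)`; for `R = A⁻¹` its norm is the energy norm lowered by one order. -/
def dualEnergyMap (R : L2 Ω →ₗ[ℝ] H01 Ω) : H01 Ω × H01 Ω →ₗ[ℝ] WithLp 2 (L2 Ω × L2Vec Ω) :=
  hilbertProd (toL2Fst Ω) (H01.gradL.toLinearMap ∘ₗ R ∘ₗ toL2Snd Ω)

/-- Writing a(x₁, v₂) = (A x₁, v₂) leaves v₂ in the L² norm, as the energy norm requires; the price
is ‖A x₁‖. -/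
theorem abs_formS_le_energyMap (x₁ : DomA Ω) (x₂ : H01 Ω) (v : H01 Ω × H01 Ω) :
    |formS (x₁.toH01, x₂) v| ≤ (‖DomA.lapL x₁‖ + ‖H01.gradL x₂‖) * ‖energyMap Ω v‖ := by
  have h : formS (x₁.toH01, x₂) v
      = ⟪x₁.lap, toL2Snd Ω v⟫_ℝ - ⟪x₂.grad, gradFst Ω v⟫_ℝ := by
    rw [formS_apply, DomA.energy_eq]
    rfl
  rw [h]
  exact abs_inner_sub_inner_le (gradFst Ω) (toL2Snd Ω) x₂.grad x₁.lap v

/-- With R = A⁻¹, a(x₁, R v₁) = (x₁, v₁) and (x₂, R v₂) = a(R x₂, R v₂). -/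
theorem formM_dualEnergyMap {R : L2 Ω →ₗ[ℝ] H01 Ω}
    (hR : ∀ g w, energy (R g) w = ⟪g, w.toL2⟫_ℝ) (x v : H01 Ω × H01 Ω) :
    formM x (R v.1.toL2, R v.2.toL2) = ⟪dualEnergyMap R x, dualEnergyMap R v⟫_ℝ := by
  have h1 : energy x.1 (R v.1.toL2) = ⟪x.1.toL2, v.1.toL2⟫_ℝ := by
    rw [energy_comm, hR, real_inner_comm]
  have h2 := hR x.2.toL2 (R v.2.toL2)
  rw [formM_apply, h1, ← h2]
  rfl

/-- Symmetry of a and a(R g, w) = (g, w) turn both terms into (x₁, x₂). -/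
theorem formS_dualEnergyMap_self {R : L2 Ω →ₗ[ℝ] H01 Ω}
    (hR : ∀ g w, energy (R g) w = ⟪g, w.toL2⟫_ℝ) (x : H01 Ω × H01 Ω) :
    formS x (R x.1.toL2, R x.2.toL2) = 0 := by
  rw [formS_apply, energy_comm, hR, energy_comm, hR, real_inner_comm, sub_self]

/-- The form equals a(x₁, R v₂) - (x₂, v₁), so x₁ costs one derivative and x₂ none: one order less
than in the energy norm. -/
theorem abs_formS_le_dualEnergyMap {R : L2 Ω →ₗ[ℝ] H01 Ω}
    (hR : ∀ g w, energy (R g) w = ⟪g, w.toL2⟫_ℝ) (x₁ : DomA Ω) (x₂ : H01 Ω)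
    (v : H01 Ω × H01 Ω) :
    |formS (x₁.toH01, x₂) (R v.1.toL2, R v.2.toL2)|
      ≤ (‖(H01.gradL ∘L DomA.toH01L) x₁‖ + ‖H01.toL2L x₂‖) * ‖dualEnergyMap R v‖ := by
  have h1 : energy x₂ (R v.1.toL2) = ⟪x₂.toL2, v.1.toL2⟫_ℝ := by
    rw [energy_comm, hR, real_inner_comm]
  have h : formS (x₁.toH01, x₂) (R v.1.toL2, R v.2.toL2)
      = ⟪x₁.toH01.grad, (H01.gradL.toLinearMap ∘ₗ R ∘ₗ toL2Snd Ω) v⟫_ℝ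
        - ⟪x₂.toL2, toL2Fst Ω v⟫_ℝ := by
    rw [formS_apply, h1]
    rfl
  rw [h]
  exact abs_inner_sub_inner_le (toL2Fst Ω) (H01.gradL.toLinearMap ∘ₗ R ∘ₗ toL2Snd Ω) x₂.toL2
    x₁.toH01.grad v

end energyNorms

end sobolev

end WaveDG

/-! ### The two nodal error estimates -/

theorem mainTheorem1 (q : ℕ) :
    ∃ C : ℝ, 0 < C ∧
      ∀ (d : ℕ) (_ : 0 < d) (Ω : Set (EuclideanSpace ℝ (Fin d)))
        (_ : IsOpen Ω) (_ : Bornology.IsBounded Ω)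
        (T : ℝ) (N : ℕ) (t : ℕ → ℝ) (_ : IsMesh T N t)
        (f : ℝ → L2 Ω) (_ : IntervalIntegrable f volume 0 T) (u₀ v₀ : H01 Ω)
        (U₁ U₂ : ℝ → H01 Ω) (_ : IsDGSolution q N t f u₀ v₀ U₁ U₂)
        (u₁ : ℝ → DomA Ω) (u₂ : ℝ → H01 Ω)
        (_ : IsSolution ((q + 1 : ℕ) : WithTop ℕ∞) N t f u₀ v₀ u₁ u₂),
        norm1 (U₁ (t N) - (u₁ (t N)).toH01) + norm0 (U₂ (t N) - u₂ (t N))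
            ≤ C * ∑ n ∈ Finset.range N, (t (n + 1) - t n) ^ (q + 1) *
                ∫ s in (t n)..(t (n + 1)),
                  (norm1 (iteratedDeriv (q + 1) u₂ s) + norm2 (iteratedDeriv (q + 1) u₁ s))
          ∧ norm0 (U₁ (t N) - (u₁ (t N)).toH01)
            ≤ C * ∑ n ∈ Finset.range N, (t (n + 1) - t n) ^ (q + 1) *
                ∫ s in (t n)..(t (n + 1)),
                  (norm0 (iteratedDeriv (q + 1) u₂ s)
                    + norm1 (iteratedDeriv (q + 1) u₁ s).toH01) := by
  obtain ⟨C, hC, herr⟩ := exists_error_le q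
  -- In the first estimate two norms are added, each bounded by the full energy norm; hence the
  -- factor 2.
  refine ⟨2 * C, by positivity, ?_⟩
  intro d hd Ω hΩ hb T N t ht f _ u₀ v₀ U₁ U₂ hU u₁ u₂ hu
  obtain ⟨R, hR⟩ := exists_solutionOperator hd hΩ hb
  set e : H01 Ω × H01 Ω := (U₁ (t N) - (u₁ (t N)).toH01, U₂ (t N) - u₂ (t N))
  constructor
  · have h := herr hΩ ht hU hu (energyMap Ω) LinearMap.id DomA.lapL H01.gradL
      (fun x v => formM_apply x v)
      (fun x => by rw [LinearMap.id_apply, formS_apply, energy_comm, sub_self])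
      abs_formS_le_energyMap
    have h1 : norm1 e.1 ≤ ‖energyMap Ω e‖ := norm_le_hilbertProd_fst (gradFst Ω) (toL2Snd Ω) e
    have h2 : norm0 e.2 ≤ ‖energyMap Ω e‖ := norm_le_hilbertProd_snd (gradFst Ω) (toL2Snd Ω) e
    refine (add_le_add h1 h2).trans ?_
    rw [← two_mul, mul_assoc]
    exact mul_le_mul_of_nonneg_left h zero_le_two
  · have h := herr hΩ ht hU hu (dualEnergyMap R)
      ((R ∘ₗ H01.toL2L.toLinearMap).prodMap (R ∘ₗ H01.toL2L.toLinearMap))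
      (H01.gradL ∘L DomA.toH01L) H01.toL2L (formM_dualEnergyMap hR)
      (formS_dualEnergyMap_self hR) (abs_formS_le_dualEnergyMap hR)
    have h1 : norm0 e.1 ≤ ‖dualEnergyMap R e‖ := norm_le_hilbertProd_fst (toL2Fst Ω) _ e
    have h2 := (norm_nonneg _).trans h
    refine (h1.trans h).trans ?_
    rw [mul_assoc]
    exact le_mul_of_one_le_left h2 one_le_two
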